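/- Theorem 1 (Schweinsberg; the paper gives a new proof). A tree on the vertex set $[n]=\{1,\dots,n\}$ is called recursive if, when it is rooted at $1$, the labels increase along every branch from the root. There is a (unique) probability law on $\mathbb{R}$, the continuous Luria–Delbrück law, whose characteristic function is $$\theta\mapsto\exp\Big(-\frac{\pi}{2}|\theta|-i\theta\ln|\theta|\Big),\qquad \theta\in\mathbb{R},$$ and the following holds for a random variable $Z$ with this law. Fix $c>0$. For $n$ so large that $\ln n\ge c$, let $T_n$ be picked uniformly at random among the $(n-1)!$ recursive trees on $[n]$. Given $T_n$, perform Bernoulli bond percolation on it with parameter $p_n=1-c/\ln n$, that is, keep each edge with probability $p_n$ and remove it with probability $1-p_n$, independently of the other edges. Let $G_n$ be the number of vertices of the cluster (connected component) that contains the root $1$. Then, as $n\to\infty$, $$\left(n^{-1}G_n-e^{-c}\right)\ln n-c\,e^{-c}\ln\ln n\;\Longrightarrow\;-c\,e^{-c}\left(Z+\ln c\right),$$ where $\Longrightarrow$ denotes convergence in law. -/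

import Mathlib

open MeasureTheory ProbabilityTheory Filter Topology

/-- A tree on the ordered vertex set `{0 < 1 < ⋯ < n - 1}` (standing for `[n] = {1, …, n}`) is
recursive if, when it is rooted at its smallest vertex `0`, the sequence of vertices along any
path that starts at the root is increasing. -/
def IsRecursiveTree {n : ℕ} [NeZero n] (T : SimpleGraph (Fin n)) : Prop :=
  T.IsTree ∧ ∀ (v : Fin n) (w : T.Walk 0 v), w.IsPath → w.support.Pairwise (· < ·)

/-- The law of the random recursive tree of size `n`: the uniform probability measure on the
(finite, nonempty) set of recursive trees on `n` vertices. -/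
noncomputable def randomRecursiveTree (n : ℕ) [NeZero n] : Measure (SimpleGraph (Fin n)) :=
  uniformOn {T | IsRecursiveTree T}

/-- Bernoulli bond percolation on the graph `G` with parameter `p`: each edge of `G` is kept with
probability `p` and removed with probability `1 - p`, independently of the other edges. This is
the law of the graph of the kept edges (with all the vertices of `G`). -/
noncomputable def bondPercolation {V : Type*} (G : SimpleGraph V) (p : unitInterval) :
    Measure (SimpleGraph V) :=
  (setBernoulli G.edgeSet p).map SimpleGraph.fromEdgeSet

/-- The law of the graph obtained by picking a random recursive tree `T` of size `n` and then,
given `T`, performing Bernoulli bond percolation on `T` with parameter `p`. -/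
noncomputable def percolatedRecursiveTree (n : ℕ) [NeZero n] (p : unitInterval) :
    Measure (SimpleGraph (Fin n)) :=
  (randomRecursiveTree n).bind fun T => bondPercolation T p

/-- The number of vertices in the connected component of the root `0`. -/
noncomputable def rootClusterSize {n : ℕ} [NeZero n] (H : SimpleGraph (Fin n)) : ℕ :=
  (H.connectedComponentMk 0).supp.ncard

/-- A law on `ℝ` is the continuous Luria–Delbrück law if its characteristic function is
`θ ↦ exp (-(π / 2) |θ| - i θ ln |θ|)`; at `θ = 0` the convention `ln 0 = 0` gives the value `1`. -/
def IsContinuousLuriaDelbruck (ν : Measure ℝ) : Prop :=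
  ∀ θ : ℝ, charFun ν θ =
    Complex.exp (-((Real.pi / 2 * |θ| : ℝ) : ℂ) - Complex.I * ((θ * Real.log |θ| : ℝ) : ℂ))

/-- The star centred at the root is a recursive tree. -/
theorem isRecursiveTree_starGraph (n : ℕ) [NeZero n] :
    IsRecursiveTree (SimpleGraph.starGraph (0 : Fin n)) := by
  refine ⟨SimpleGraph.isTree_starGraph 0, fun v w hw => ?_⟩
  by_cases hv : v = 0
  · subst hv
    rw [SimpleGraph.Walk.isPath_iff_nil.1 hw |>.eq_nil]
    simp
  · have hadj : (SimpleGraph.starGraph (0 : Fin n)).Adj 0 v :=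
      SimpleGraph.starGraph_center_adj (Ne.symm hv)
    have hpath : hadj.toWalk.IsPath := by
      simp [SimpleGraph.Walk.cons_isPath_iff, Ne.symm hv]
    have h := (SimpleGraph.isTree_starGraph (0 : Fin n)).existsUnique_path 0 v
    rw [h.unique hw hpath]
    simpa using Fin.pos_iff_ne_zero.2 hv

instance instMeasurableSingletonClassSimpleGraph {V : Type*} [Countable V] :
    MeasurableSingletonClass (SimpleGraph V) where
  measurableSet_singleton G := by
    have h : ({G} : Set (SimpleGraph V)) = SimpleGraph.edgeSet ⁻¹' {G.edgeSet} := by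
      ext H
      simp
    rw [h]
    exact SimpleGraph.measurable_edgeSet (measurableSet_singleton _)

instance instIsProbabilityMeasureRandomRecursiveTree (n : ℕ) [NeZero n] :
    IsProbabilityMeasure (randomRecursiveTree n) :=
  isProbabilityMeasure_uniformOn (Set.toFinite _) ⟨_, isRecursiveTree_starGraph n⟩

instance instIsProbabilityMeasureBondPercolation {V : Type*} (G : SimpleGraph V)
    (p : unitInterval) : IsProbabilityMeasure (bondPercolation G p) :=
  Measure.isProbabilityMeasure_map SimpleGraph.measurable_fromEdgeSet.aemeasurable

instance instIsProbabilityMeasurePercolatedRecursiveTree (n : ℕ) [NeZero n] (p : unitInterval) :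
    IsProbabilityMeasure (percolatedRecursiveTree n p) :=
  isProbabilityMeasure_bind Measurable.of_discrete.aemeasurable
    (ae_of_all _ fun T => instIsProbabilityMeasureBondPercolation T p)

/-!
While the tree grows, the size `G` of the root cluster is a Markov chain: when there are `k`
vertices, the next one joins the root cluster with probability `p G / k`. Hence, with
`risingProd s g = ∏ k ∈ [1, g), (1 + s / k) = Γ(g + s) / (Γ(g) Γ(1 + s))`, which satisfies
`risingProd s (g + 1) - risingProd s g = (s / g) risingProd s g`, the expectation of
`risingProd s G` gets multiplied by `1 + s p / k` at this step, and
`𝔼 [risingProd s G_n] = risingProd (s p) n` for every complex `s` (`integral_risingProd`). This is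
an explicit Mellin transform of `G_n`, and the theorem is read off from it at
`s = i θ ln n`, `s p = i θ (ln n - c)`.

On the one hand, for imaginary `s` the quotient `risingProd s G / risingProd s n` differs from
`(G / n) ^ s` by `O(|s| ^ 2 / G)` (`norm_risingProd_div_sub_le`), and this is negligible in mean, as
`𝔼 [1 / G_n] ≤ 𝔼 [risingProd (-1/2) G_n] = risingProd (-p/2) n ≤ n ^ (-1/4)`
(`integral_inv_rootClusterSize_le`). On the other hand, with `T = θ ln n` and `a = θ c`,
`risingProd (s p) n / risingProd s n = ∏ (1 - i a / (k + i T))` is equivalent to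
`exp (-i a (log (n + i T) - log (1 + i T)))` (`norm_risingProd_ratio_sub_le`), where
`log (1 + i T) = ln (ln n) + ln |θ| + i (π / 2) sign θ + o(1)`. So the characteristic function of
`ln n * (ln (G_n / n) + c) - c * ln (ln n)` converges to
`exp (-(π / 2) c |θ| + i c θ ln |θ|)` (`tendsto_integral_exp_logStat`). The limit is continuous at
`0`; by Prokhorov's theorem it is a characteristic function, which for `c = 1` and after a
reflection gives the existence of the continuous Luria–Delbrück law. Linearising the logarithm,
with an error that vanishes in probability by tightness, turns this into the convergence of the
characteristic functions of the normalised cluster sizes (`tendsto_integral_exp_sizeStat`), and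
Lévy's theorem concludes.

The Markov property (`integral_rootClusterSize_succ`) rests on a bijection: adding a leaf to
a recursive tree on `n` vertices, at an arbitrary vertex, yields every recursive tree on `n + 1`
vertices exactly once (`bijOn_addLeaf`).
-/

/-! ### Recursive trees and their growth -/

namespace SimpleGraph.Walk

variable {V : Type*} [Preorder V] {G : SimpleGraph V}

/-- The endpoint of a walk with increasing support is its largest vertex. -/
theorem le_end_of_support_pairwise_lt {u v : V} (w : G.Walk u v)
    (hw : w.support.Pairwise (· < ·)) : ∀ x ∈ w.support, x ≤ v := by
  intro x hx
  by_cases hn : w.Nil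
  · cases hn
    simp only [support_nil, List.mem_singleton] at hx
    exact hx.le
  · rw [← concat_dropLast (adj_penultimate hn), support_concat] at hw hx
    rw [List.pairwise_append] at hw
    rcases List.mem_append.1 hx with hx | hx
    · exact (hw.2.2 x hx v (by simp)).le
    · exact (List.mem_singleton.1 hx).le

theorem penultimate_lt_of_support_pairwise_lt {u v : V} (w : G.Walk u v) (hn : ¬ w.Nil)
    (hw : w.support.Pairwise (· < ·)) : w.penultimate < v := by
  rw [← concat_dropLast (adj_penultimate hn), support_concat,
    List.pairwise_append] at hw
  exact hw.2.2 _ (end_mem_support _) v (by simp)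

theorem support_concat_pairwise_lt {u v x : V} (w : G.Walk u v)
    (hw : w.support.Pairwise (· < ·)) (h : G.Adj v x) (hvx : v < x) :
    (w.concat h).support.Pairwise (· < ·) := by
  rw [support_concat, List.pairwise_append]
  refine ⟨hw, by simp, fun y hy z hz => ?_⟩
  rw [List.mem_singleton.1 hz]
  exact (le_end_of_support_pairwise_lt w hw y hy).trans_lt hvx

theorem isPath_of_support_pairwise_lt {u v : V} (w : G.Walk u v)
    (hw : w.support.Pairwise (· < ·)) : w.IsPath :=
  (isPath_def _).2 (hw.imp fun h => h.ne)

end SimpleGraph.Walk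

section Growth

open SimpleGraph

/-- A graph is a recursive tree if and only if every vertex other than the root has exactly one
smaller neighbour, its parent. -/
theorem isRecursiveTree_iff {n : ℕ} [NeZero n] {T : SimpleGraph (Fin n)} :
    IsRecursiveTree T ↔ ∀ v ≠ 0, ∃! u, u < v ∧ T.Adj u v := by
  constructor
  · rintro ⟨hT, hinc⟩ v hv
    obtain ⟨w, hw, huniq⟩ := hT.existsUnique_path 0 v
    have hn : ¬ w.Nil := fun h => hv h.eq.symm
    refine ⟨w.penultimate, ⟨w.penultimate_lt_of_support_pairwise_lt hn (hinc v w hw),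
      Walk.adj_penultimate hn⟩, ?_⟩
    rintro u ⟨huv, hadj⟩
    obtain ⟨q, hq, -⟩ := hT.existsUnique_path 0 u
    have hqc := q.support_concat_pairwise_lt (hinc u q hq) hadj huv
    rw [← huniq _ (Walk.isPath_of_support_pairwise_lt _ hqc), Walk.penultimate_concat]
  · intro h
    have key : ∀ v, ∃ w : T.Walk 0 v, w.support.Pairwise (· < ·) := by
      intro v
      induction v using WellFoundedLT.induction with
      | ind v ih =>
        by_cases hv : v = 0
        · subst hv
          exact ⟨Walk.nil, by simp⟩
        · obtain ⟨u, ⟨huv, hadj⟩, -⟩ := h v hv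
          obtain ⟨w, hw⟩ := ih u huv
          exact ⟨w.concat hadj, w.support_concat_pairwise_lt hw hadj huv⟩
    have hconn : T.Connected :=
      (connected_iff_exists_forall_reachable _).2 ⟨0, fun v => ⟨(key v).choose⟩⟩
    choose! par hpar using fun v hv => (h v hv).exists
    -- every edge joins its larger endpoint to the parent of that endpoint
    have hsurj : Function.Surjective
        (fun v : {v : Fin n // v ≠ 0} => (⟨s(par v, v), (hpar v v.2).2⟩ : T.edgeSet)) := by
      rintro ⟨e, he⟩
      induction e using Sym2.ind with
      | _ a b =>
        wlog hab : a < b generalizing a b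
        · obtain ⟨v, hv⟩ := this b a (adj_symm T he)
            (lt_of_le_of_ne (not_lt.1 hab) (T.ne_of_adj he).symm)
          exact ⟨v, by rw [hv]; simp [Sym2.eq_swap]⟩
        have hb : b ≠ 0 := ((Fin.zero_le a).trans_lt hab).ne'
        exact ⟨⟨b, hb⟩, Subtype.ext (by
          simp [(h b hb).unique (hpar b hb) ⟨hab, he⟩])⟩
    have hcard : Nat.card T.edgeSet + 1 = Nat.card (Fin n) := by
      refine le_antisymm ?_ hconn.card_vert_le_card_edgeSet_add_one
      have h1 : Nat.card T.edgeSet ≤ _ := Nat.card_le_card_of_surjective _ hsurj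
      have h2 : Nat.card {v : Fin n // v ≠ 0} = n - 1 := by
        simp [Nat.card_eq_fintype_card, Fintype.card_subtype_compl]
      have h3 : n ≠ 0 := NeZero.ne n
      rw [Nat.card_fin]
      omega
    have htree : T.IsTree := isTree_iff_connected_and_card.2 ⟨hconn, hcard⟩
    refine ⟨htree, fun v w hw => ?_⟩
    obtain ⟨q, hq⟩ := key v
    rwa [(htree.existsUnique_path 0 v).unique hw (q.isPath_of_support_pairwise_lt hq)]

namespace SimpleGraph

/-- The graph `G` on `Fin n`, seen as a graph on `Fin (n + 1)` in which the new vertex is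
isolated. -/
def addVertex {n : ℕ} (G : SimpleGraph (Fin n)) : SimpleGraph (Fin (n + 1)) :=
  G.map Fin.castSuccEmb

/-- The graph on `Fin (n + 1)` obtained from `G` by joining a new vertex to the vertex `j`. -/
def addLeaf {n : ℕ} (G : SimpleGraph (Fin n)) (j : Fin n) : SimpleGraph (Fin (n + 1)) :=
  G.addVertex ⊔ edge j.castSucc (Fin.last n)

variable {n : ℕ} {G : SimpleGraph (Fin n)} {j a b : Fin n}

@[simp] theorem addVertex_adj_castSucc : G.addVertex.Adj a.castSucc b.castSucc ↔ G.Adj a b := by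
  simp only [addVertex, map_adj]
  constructor
  · rintro ⟨u, v, h, hu, hv⟩
    rwa [← Fin.castSucc_injective _ hu, ← Fin.castSucc_injective _ hv]
  · exact fun h => ⟨a, b, h, rfl, rfl⟩

@[simp] theorem not_addVertex_adj_last (v : Fin (n + 1)) : ¬ G.addVertex.Adj v (Fin.last n) := by
  simp only [addVertex, map_adj, not_exists, not_and]
  exact fun u w _ _ hw => (Fin.castSucc_lt_last w).ne hw

@[simp] theorem not_addVertex_last_adj (v : Fin (n + 1)) : ¬ G.addVertex.Adj (Fin.last n) v :=
  fun h => not_addVertex_adj_last v h.symm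

@[simp] theorem addLeaf_adj_castSucc :
    (G.addLeaf j).Adj a.castSucc b.castSucc ↔ G.Adj a b := by
  simp [addLeaf, edge_adj, (Fin.castSucc_lt_last _).ne]

@[simp] theorem addLeaf_adj_last : (G.addLeaf j).Adj a.castSucc (Fin.last n) ↔ a = j := by
  simp [addLeaf, edge_adj, (Fin.castSucc_lt_last _).ne]

@[simp] theorem addLeaf_last_adj : (G.addLeaf j).Adj (Fin.last n) a.castSucc ↔ a = j := by
  rw [adj_comm, addLeaf_adj_last]

end SimpleGraph

/-- Unique existence over `Fin (n + 1)` when the last element is excluded. -/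
theorem existsUnique_fin_succ_iff {n : ℕ} {P : Fin (n + 1) → Prop} (h : ¬ P (Fin.last n)) :
    (∃! u, P u) ↔ ∃! u : Fin n, P u.castSucc := by
  constructor
  · rintro ⟨u, hu, huniq⟩
    induction u using Fin.lastCases with
    | last => exact absurd hu h
    | cast u => exact ⟨u, hu, fun v hv => Fin.castSucc_injective _ (huniq _ hv)⟩
  · rintro ⟨u, hu, huniq⟩
    refine ⟨u.castSucc, hu, fun v hv => ?_⟩
    induction v using Fin.lastCases with
    | last => exact absurd hv h
    | cast v => rw [huniq v hv]

theorem isRecursiveTree_addLeaf_iff {n : ℕ} [NeZero n] {T : SimpleGraph (Fin n)} {j : Fin n} :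
    IsRecursiveTree (T.addLeaf j) ↔ IsRecursiveTree T := by
  rw [isRecursiveTree_iff, isRecursiveTree_iff, Fin.forall_fin_succ']
  have hlast : Fin.last n ≠ 0 → ∃! u, u < Fin.last n ∧ (T.addLeaf j).Adj u (Fin.last n) := by
    intro _
    rw [existsUnique_fin_succ_iff (by simp)]
    exact ⟨j, by simp [Fin.castSucc_lt_last], fun v hv => by simpa using hv.2⟩
  rw [and_iff_left hlast]
  refine forall_congr' fun v => imp_congr (by simp) ?_
  rw [existsUnique_fin_succ_iff (fun h => (Fin.castSucc_lt_last v).not_gt h.1)]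
  simp

/-- Adding a leaf to a recursive tree on `n` vertices, at any one of these vertices, produces
each recursive tree on `n + 1` vertices exactly once. -/
theorem bijOn_addLeaf (n : ℕ) [NeZero n] :
    Set.BijOn (fun x : SimpleGraph (Fin n) × Fin n => x.1.addLeaf x.2)
      ({T | IsRecursiveTree T} ×ˢ Set.univ) {T | IsRecursiveTree T} := by
  refine ⟨fun x hx => isRecursiveTree_addLeaf_iff.2 hx.1, ?_, ?_⟩
  · rintro ⟨S, i⟩ - ⟨T, j⟩ - h
    simp only at h
    refine Prod.ext ?_ ?_
    · ext a b
      rw [← addLeaf_adj_castSucc (G := S) (j := i), h, addLeaf_adj_castSucc]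
    · have hi : (S.addLeaf i).Adj i.castSucc (Fin.last n) := addLeaf_adj_last.2 rfl
      rw [h] at hi
      exact addLeaf_adj_last.1 hi
  · intro T hT
    have hlast : Fin.last n ≠ 0 := (Fin.pos_iff_ne_zero).1 (Fin.last_pos' )
    obtain ⟨j, hj, huniq⟩ := (existsUnique_fin_succ_iff (by simp)).1
      (isRecursiveTree_iff.1 hT (Fin.last n) hlast)
    have hTj : (T.comap Fin.castSucc).addLeaf j = T := by
      have h1 : ∀ a : Fin n, a = j ↔ T.Adj a.castSucc (Fin.last n) := fun a =>
        ⟨fun h => h ▸ hj.2, fun h => huniq a ⟨Fin.castSucc_lt_last a, h⟩⟩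
      ext a b
      induction a using Fin.lastCases with
      | last =>
        induction b using Fin.lastCases with
        | last => simp
        | cast b => rw [addLeaf_last_adj, h1, adj_comm]
      | cast a =>
        induction b using Fin.lastCases with
        | last => rw [addLeaf_adj_last, h1]
        | cast b => rw [addLeaf_adj_castSucc, comap_adj]
    refine ⟨(T.comap Fin.castSucc, j), ⟨?_, Set.mem_univ _⟩, hTj⟩
    rw [Set.mem_ofPred_eq, ← isRecursiveTree_addLeaf_iff (j := j), hTj]
    exact hT

/-! ### The root cluster after adding a vertex -/

namespace SimpleGraph

/-- A set that contains `v`, is closed under adjacency and consists of vertices reachable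
from `v` is the connected component of `v`. -/
theorem supp_connectedComponentMk_eq {V : Type*} {G : SimpleGraph V} {v : V} {C : Set V}
    (hv : v ∈ C) (hC : ∀ a ∈ C, ∀ b, G.Adj a b → b ∈ C) (hr : ∀ a ∈ C, G.Reachable v a) :
    (G.connectedComponentMk v).supp = C := by
  have key : ∀ a b : V, G.Walk a b → a ∈ C → b ∈ C := by
    intro a b w
    induction w with
    | nil => exact id
    | cons hadj w ih => exact fun ha => ih (hC _ ha _ hadj)
  ext x
  rw [ConnectedComponent.mem_supp_iff, ConnectedComponent.eq]
  refine ⟨fun h => ?_, fun h => (hr x h).symm⟩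
  obtain ⟨w⟩ := h.symm
  exact key _ _ w hv

end SimpleGraph

/-- The connected component of the root. -/
def rootCluster {n : ℕ} [NeZero n] (G : SimpleGraph (Fin n)) : Set (Fin n) :=
  (G.connectedComponentMk 0).supp

section

variable {n : ℕ} [NeZero n] {G : SimpleGraph (Fin n)} {a b : Fin n}

theorem mem_rootCluster_iff : a ∈ rootCluster G ↔ G.Reachable 0 a := by
  rw [rootCluster, ConnectedComponent.mem_supp_iff, ConnectedComponent.eq, reachable_comm]

theorem mem_rootCluster_of_adj (ha : a ∈ rootCluster G) (h : G.Adj a b) : b ∈ rootCluster G :=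
  mem_rootCluster_iff.2 ((mem_rootCluster_iff.1 ha).trans h.reachable)

theorem rootClusterSize_eq_ncard : rootClusterSize G = (rootCluster G).ncard := rfl

theorem rootClusterSize_pos : 0 < rootClusterSize G :=
  (Set.ncard_pos (Set.toFinite _)).2 ⟨0, mem_rootCluster_iff.2 (Reachable.refl _)⟩

theorem rootClusterSize_le : rootClusterSize G ≤ n := by
  rw [rootClusterSize_eq_ncard]
  simpa using Set.ncard_le_card (rootCluster G)

theorem reachable_castSucc {H : SimpleGraph (Fin (n + 1))} (ha : a ∈ rootCluster G)
    (hGH : ∀ u v, G.Adj u v → H.Adj u.castSucc v.castSucc) : H.Reachable 0 a.castSucc := by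
  have h := (mem_rootCluster_iff.1 ha).map (⟨Fin.castSucc, @hGH⟩ : G →g H)
  simpa using h

theorem rootCluster_addVertex : rootCluster G.addVertex = Fin.castSucc '' rootCluster G := by
  refine supp_connectedComponentMk_eq
    ⟨0, mem_rootCluster_iff.2 (Reachable.refl _), Fin.castSucc_zero'⟩ ?_ ?_
  · rintro _ ⟨a, ha, rfl⟩ b hb
    induction b using Fin.lastCases with
    | last => exact absurd hb (not_addVertex_adj_last _)
    | cast b => exact ⟨b, mem_rootCluster_of_adj ha (addVertex_adj_castSucc.1 hb), rfl⟩
  · rintro _ ⟨a, ha, rfl⟩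
    exact reachable_castSucc ha fun u v => addVertex_adj_castSucc.2

theorem rootClusterSize_addVertex : rootClusterSize G.addVertex = rootClusterSize G := by
  rw [rootClusterSize_eq_ncard, rootCluster_addVertex,
    Set.ncard_image_of_injective _ (Fin.castSucc_injective n), rootClusterSize_eq_ncard]

theorem rootCluster_addLeaf_of_mem {j : Fin n} (hj : j ∈ rootCluster G) :
    rootCluster (G.addLeaf j) = insert (Fin.last n) (Fin.castSucc '' rootCluster G) := by
  refine supp_connectedComponentMk_eq
    (Or.inr ⟨0, mem_rootCluster_iff.2 (Reachable.refl _), Fin.castSucc_zero'⟩) ?_ ?_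
  · rintro _ (rfl | ⟨a, ha, rfl⟩) b hb
    · induction b using Fin.lastCases with
      | last => exact Or.inl rfl
      | cast b => exact Or.inr ⟨b, addLeaf_last_adj.1 hb ▸ hj, rfl⟩
    · induction b using Fin.lastCases with
      | last => exact Or.inl rfl
      | cast b => exact Or.inr ⟨b, mem_rootCluster_of_adj ha (addLeaf_adj_castSucc.1 hb), rfl⟩
  · rintro _ (rfl | ⟨a, ha, rfl⟩)
    · refine (reachable_castSucc hj fun u v => addLeaf_adj_castSucc.2).trans
        (Adj.reachable (addLeaf_adj_last.2 rfl))
    · exact reachable_castSucc ha fun u v => addLeaf_adj_castSucc.2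

theorem rootCluster_addLeaf_of_notMem {j : Fin n} (hj : j ∉ rootCluster G) :
    rootCluster (G.addLeaf j) = Fin.castSucc '' rootCluster G := by
  refine supp_connectedComponentMk_eq
    ⟨0, mem_rootCluster_iff.2 (Reachable.refl _), Fin.castSucc_zero'⟩ ?_ ?_
  · rintro _ ⟨a, ha, rfl⟩ b hb
    induction b using Fin.lastCases with
    | last => exact absurd (addLeaf_adj_last.1 hb ▸ ha) hj
    | cast b => exact ⟨b, mem_rootCluster_of_adj ha (addLeaf_adj_castSucc.1 hb), rfl⟩
  · rintro _ ⟨a, ha, rfl⟩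
    exact reachable_castSucc ha fun u v => addLeaf_adj_castSucc.2

open scoped Classical in
theorem rootClusterSize_addLeaf (j : Fin n) :
    rootClusterSize (G.addLeaf j) =
      if j ∈ rootCluster G then rootClusterSize G + 1 else rootClusterSize G := by
  split_ifs with hj
  · rw [rootClusterSize_eq_ncard, rootCluster_addLeaf_of_mem hj, Set.ncard_insert_of_notMem,
      Set.ncard_image_of_injective _ (Fin.castSucc_injective n), rootClusterSize_eq_ncard]
    rintro ⟨a, -, ha⟩
    exact (Fin.castSucc_lt_last a).ne ha
  · rw [rootClusterSize_eq_ncard, rootCluster_addLeaf_of_notMem hj,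
      Set.ncard_image_of_injective _ (Fin.castSucc_injective n), rootClusterSize_eq_ncard]

end

/-! ### The one-step recursion for the size of the root cluster -/

section setBernoulli

variable {ι κ : Type*} [Finite ι] [Finite κ]

theorem integral_setBernoulli (u : Finset ι) (p : unitInterval) (F : Set ι → ℂ) :
    ∫ S, F S ∂setBernoulli (u : Set ι) p =
      ∑ S ∈ u.powerset, ((p : ℝ) ^ S.card * (1 - p : ℝ) ^ (u.card - S.card)) • F S := by
  classical
  cases nonempty_fintype ι
  rw [integral_fintype (Integrable.of_finite),
    ← Fintype.finsetEquivSet.sum_comp, ← Finset.sum_subset (Finset.subset_univ u.powerset)]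
  · refine Finset.sum_congr rfl fun S hS => ?_
    have hSu := Finset.mem_powerset.1 hS
    rw [Fintype.finsetEquivSet_apply,
      setBernoulli_real_singleton p (Finset.coe_subset.2 hSu) u.finite_toSet,
      Set.ncard_coe_finset, ← Finset.coe_sdiff, Set.ncard_coe_finset,
      Finset.card_sdiff_of_subset hSu]
  · intro S _ hS
    rw [Fintype.finsetEquivSet_apply, measureReal_def, setBernoulli_singleton_of_not_subset,
      ENNReal.toReal_zero, zero_smul]
    exact fun h => hS (Finset.mem_powerset.2 (Finset.coe_subset.1 h))

/-- Conditioning on whether a given element belongs to the random set. -/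
theorem integral_setBernoulli_insert {u : Set ι} {e : ι} (he : e ∉ u) (p : unitInterval)
    (F : Set ι → ℂ) :
    ∫ S, F S ∂setBernoulli (insert e u) p =
      (p : ℝ) * ∫ S, F (insert e S) ∂setBernoulli u p
        + (1 - p : ℝ) * ∫ S, F S ∂setBernoulli u p := by
  classical
  lift u to Finset ι using u.toFinite
  rw [← Finset.coe_insert, integral_setBernoulli, integral_setBernoulli, integral_setBernoulli,
    Finset.sum_powerset_insert (by simpa using he), add_comm, Finset.mul_sum, Finset.mul_sum]
  have hcard : (insert e u).card = u.card + 1 := Finset.card_insert_of_notMem (by simpa using he)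
  congr 1
  · refine Finset.sum_congr rfl fun S hS => ?_
    have hSe : e ∉ S := fun h => he (by simpa using Finset.mem_powerset.1 hS h)
    rw [Finset.card_insert_of_notMem hSe, hcard, Nat.add_sub_add_right, Finset.coe_insert]
    simp only [Complex.real_smul]
    push_cast
    ring
  · refine Finset.sum_congr rfl fun S hS => ?_
    rw [hcard, Nat.succ_sub (Finset.card_le_card (Finset.mem_powerset.1 hS)), pow_succ]
    simp only [Complex.real_smul]
    push_cast
    ring

theorem integral_setBernoulli_image {f : ι → κ} (hf : Function.Injective f) (u : Set ι)
    (p : unitInterval) (F : Set κ → ℂ) :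
    ∫ S, F S ∂setBernoulli (f '' u) p = ∫ S, F (f '' S) ∂setBernoulli u p := by
  classical
  lift u to Finset ι using u.toFinite
  rw [← Finset.coe_image, integral_setBernoulli, integral_setBernoulli, Finset.powerset_image,
    Finset.sum_image fun S _ T _ h => Finset.image_injective hf h]
  simp [Finset.card_image_of_injective _ hf]

end setBernoulli

namespace SimpleGraph

variable {n : ℕ}

theorem edgeSet_addVertex (G : SimpleGraph (Fin n)) :
    G.addVertex.edgeSet = Sym2.map Fin.castSucc '' G.edgeSet := by
  rw [addVertex, edgeSet_map]
  rfl

theorem edgeSet_addLeaf (G : SimpleGraph (Fin n)) (j : Fin n) :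
    (G.addLeaf j).edgeSet =
      insert s(j.castSucc, Fin.last n) (Sym2.map Fin.castSucc '' G.edgeSet) := by
  rw [addLeaf, edgeSet_sup, edgeSet_addVertex, edgeSet_edge_of_ne (Fin.castSucc_lt_last j).ne,
    Set.union_comm, Set.singleton_union]

theorem fromEdgeSet_image_castSucc (S : Set (Sym2 (Fin n))) :
    fromEdgeSet (Sym2.map Fin.castSucc '' S) = (fromEdgeSet S).addVertex := by
  refine edgeSet_injective ?_
  rw [edgeSet_addVertex, edgeSet_fromEdgeSet, edgeSet_fromEdgeSet]
  have hinj : Function.Injective (Sym2.map (Fin.castSucc (n := n))) :=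
    Sym2.map.injective (Fin.castSucc_injective n)
  rw [Set.image_sdiff hinj]
  ext e
  simp only [Set.mem_sdiff]
  refine and_congr_right fun he => not_congr ?_
  obtain ⟨e, -, rfl⟩ := he
  rw [hinj.mem_set_image]
  induction e using Sym2.ind with
  | _ a b => simp

theorem fromEdgeSet_insert_image_castSucc (S : Set (Sym2 (Fin n))) (j : Fin n) :
    fromEdgeSet (insert s(j.castSucc, Fin.last n) (Sym2.map Fin.castSucc '' S)) =
      (fromEdgeSet S).addLeaf j := by
  rw [Set.insert_eq, fromEdgeSet_union, fromEdgeSet_image_castSucc, addLeaf, edge, sup_comm]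

end SimpleGraph

theorem integral_bondPercolation {V : Type*} [Finite V] (G : SimpleGraph V) (p : unitInterval)
    (F : SimpleGraph V → ℂ) :
    ∫ H, F H ∂bondPercolation G p = ∫ S, F (fromEdgeSet S) ∂setBernoulli G.edgeSet p :=
  integral_map measurable_fromEdgeSet.aemeasurable
    (Measurable.of_discrete).aestronglyMeasurable

theorem integral_bondPercolation_addLeaf {n : ℕ} (G : SimpleGraph (Fin n)) (j : Fin n)
    (p : unitInterval) (F : SimpleGraph (Fin (n + 1)) → ℂ) :
    ∫ H, F H ∂bondPercolation (G.addLeaf j) p =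
      (p : ℝ) * ∫ H, F (H.addLeaf j) ∂bondPercolation G p
        + (1 - p : ℝ) * ∫ H, F H.addVertex ∂bondPercolation G p := by
  have hj : s(j.castSucc, Fin.last n) ∉ Sym2.map Fin.castSucc '' G.edgeSet := by
    rw [← edgeSet_addVertex, mem_edgeSet]
    exact not_addVertex_adj_last _
  have hinj : Function.Injective (Sym2.map (Fin.castSucc (n := n))) :=
    Sym2.map.injective (Fin.castSucc_injective n)
  rw [integral_bondPercolation, edgeSet_addLeaf, integral_setBernoulli_insert hj,
    integral_setBernoulli_image hinj, integral_setBernoulli_image hinj,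
    integral_bondPercolation, integral_bondPercolation]
  simp only [fromEdgeSet_image_castSucc, fromEdgeSet_insert_image_castSucc]

open scoped Classical in
theorem integral_randomRecursiveTree {n : ℕ} [NeZero n] (g : SimpleGraph (Fin n) → ℂ) :
    ∫ T, g T ∂randomRecursiveTree n =
      ((Finset.univ.filter fun T : SimpleGraph (Fin n) => IsRecursiveTree T).card : ℂ)⁻¹ *
        ∑ T with IsRecursiveTree T, g T := by
  set R := Finset.univ.filter fun T : SimpleGraph (Fin n) => IsRecursiveTree T with hR
  have hRset : {T : SimpleGraph (Fin n) | IsRecursiveTree T} = R := by ext; simp [hR]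
  rw [randomRecursiveTree, uniformOn, ProbabilityTheory.cond, hRset, integral_smul_measure,
    setIntegral_finset _ Integrable.of_finite.integrableOn, Measure.count_apply_finset]
  simp [measureReal_def, Complex.real_smul]

theorem integral_percolatedRecursiveTree {n : ℕ} [NeZero n] (p : unitInterval)
    (F : SimpleGraph (Fin n) → ℂ) :
    ∫ H, F H ∂percolatedRecursiveTree n p =
      ∫ T, ∫ H, F H ∂bondPercolation T p ∂randomRecursiveTree n := by
  let K : Kernel (SimpleGraph (Fin n)) (SimpleGraph (Fin n)) :=
    ⟨fun T => bondPercolation T p, Measurable.of_discrete⟩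
  have : IsMarkovKernel K := ⟨fun T => inferInstanceAs (IsProbabilityMeasure (bondPercolation T p))⟩
  exact Kernel.integral_comp (η := K) (κ := Kernel.const Unit (randomRecursiveTree n)) (a := ())
    Integrable.of_finite

/-- Markov property of the growth of the root cluster: the new vertex joins it with probability
`p` times the proportion of the present vertices that it contains. -/
theorem integral_rootClusterSize_succ {n : ℕ} [NeZero n] (p : unitInterval) (f : ℕ → ℂ) :
    ∫ H, f (rootClusterSize H) ∂percolatedRecursiveTree (n + 1) p =
      ∫ H, (f (rootClusterSize H) + p * (rootClusterSize H / n) *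
        (f (rootClusterSize H + 1) - f (rootClusterSize H))) ∂percolatedRecursiveTree n p := by
  classical
  have hn : (n : ℂ) ≠ 0 := Nat.cast_ne_zero.2 (NeZero.ne n)
  have hbij := bijOn_addLeaf n
  have hsum : ∀ g : SimpleGraph (Fin (n + 1)) → ℂ,
      ∑ T with IsRecursiveTree T, g T =
        ∑ T : SimpleGraph (Fin n) with IsRecursiveTree T, ∑ j, g (T.addLeaf j) := by
    intro g
    rw [← Finset.sum_product']
    symm
    refine Finset.sum_nbij (fun x => x.1.addLeaf x.2) ?_ ?_ ?_ fun _ _ => rfl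
    · intro x hx
      simpa using hbij.mapsTo (by simpa using hx)
    · refine hbij.injOn.mono fun x hx => by simpa using hx
    · convert! hbij.surjOn using 1 <;> ext <;> simp
  have hcard : ((Finset.univ.filter fun T : SimpleGraph (Fin (n + 1)) =>
      IsRecursiveTree T).card : ℂ) =
      (Finset.univ.filter fun T : SimpleGraph (Fin n) => IsRecursiveTree T).card * n := by
    simpa using hsum fun _ => 1
  rw [integral_percolatedRecursiveTree, integral_percolatedRecursiveTree,
    integral_randomRecursiveTree, integral_randomRecursiveTree, hsum, hcard, mul_inv, mul_assoc]
  congr 1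
  rw [Finset.mul_sum]
  refine Finset.sum_congr rfl fun T _ => ?_
  have hstep : ∀ (H : SimpleGraph (Fin n)) (j : Fin n), f (rootClusterSize (H.addLeaf j)) =
      f (rootClusterSize H) + (if j ∈ rootCluster H then 1 else 0) *
        (f (rootClusterSize H + 1) - f (rootClusterSize H)) := by
    intro H j
    rw [rootClusterSize_addLeaf]
    split_ifs <;> ring
  have hcount : ∀ H : SimpleGraph (Fin n),
      ∑ j, (if j ∈ rootCluster H then (1 : ℂ) else 0) = rootClusterSize H := by
    intro H
    rw [Finset.sum_boole, rootClusterSize_eq_ncard, Set.ncard_eq_toFinset_card']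
    congr 2
    ext
    simp
  simp only [integral_bondPercolation_addLeaf, rootClusterSize_addVertex, hstep]
  rw [Finset.sum_add_distrib, ← Finset.mul_sum,
    ← integral_finsetSum _ fun _ _ => Integrable.of_finite, Finset.sum_const, Finset.card_univ,
    Fintype.card_fin, nsmul_eq_mul]
  simp only [Finset.sum_add_distrib, ← Finset.sum_mul, hcount, Finset.sum_const, Finset.card_univ,
    Fintype.card_fin, nsmul_eq_mul]
  rw [← integral_const_mul, ← integral_const_mul, ← integral_const_mul,
    ← integral_add Integrable.of_finite Integrable.of_finite, ← integral_const_mul]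
  congr 1
  ext H
  field_simp
  push_cast
  ring

theorem integral_rootClusterSize_one (p : unitInterval) (f : ℕ → ℂ) :
    ∫ H, f (rootClusterSize H) ∂percolatedRecursiveTree 1 p = f 1 := by
  have h : ∀ H : SimpleGraph (Fin 1), rootClusterSize H = 1 := fun H =>
    le_antisymm rootClusterSize_le rootClusterSize_pos
  simp [h]

end Growth

/-! ### The Mellin transform of the root cluster size -/

/-- The function `g ↦ Γ(g + s) / (Γ(g) Γ(1 + s))`, as a product; it is the eigenfunction, with
growth exponent `s`, of the growth of the root cluster. -/
noncomputable def risingProd (s : ℂ) (g : ℕ) : ℂ := ∏ k ∈ Finset.Ico 1 g, (1 + s / k)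

theorem risingProd_succ (s : ℂ) {g : ℕ} (hg : 1 ≤ g) :
    risingProd s (g + 1) = risingProd s g * (1 + s / g) :=
  Finset.prod_Ico_succ_top hg _

theorem integral_risingProd (s : ℂ) (p : unitInterval) (n : ℕ) [NeZero n] :
    ∫ H, risingProd s (rootClusterSize H) ∂percolatedRecursiveTree n p
      = risingProd (s * p) n := by
  have key : ∀ m : ℕ, ∫ H, risingProd s (rootClusterSize H) ∂percolatedRecursiveTree (m + 1) p
      = risingProd (s * p) (m + 1) := by
    intro m
    induction m with
    | zero =>
      rw [integral_rootClusterSize_one]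
      simp [risingProd]
    | succ m ih =>
      rw [integral_rootClusterSize_succ, risingProd_succ _ (by omega), ← ih, ← integral_mul_const]
      congr 1
      ext H
      have hG : (rootClusterSize H : ℂ) ≠ 0 := Nat.cast_ne_zero.2 rootClusterSize_pos.ne'
      rw [risingProd_succ _ rootClusterSize_pos]
      field_simp
      push_cast
      ring
  obtain ⟨m, rfl⟩ : ∃ m, n = m + 1 := Nat.exists_eq_succ_of_ne_zero (NeZero.ne n)
  exact key m

/-! ### Asymptotics of products -/

theorem norm_prod_sub_prod_le_sum {ι : Type*} (s : Finset ι) (x y : ι → ℂ)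
    (hx : ∀ i ∈ s, ‖x i‖ ≤ 1) (hy : ∀ i ∈ s, ‖y i‖ ≤ 1) :
    ‖∏ i ∈ s, x i - ∏ i ∈ s, y i‖ ≤ ∑ i ∈ s, ‖x i - y i‖ := by
  classical
  induction s using Finset.induction_on with
  | empty => simp
  | insert i s hi ih =>
    rw [Finset.prod_insert hi, Finset.prod_insert hi, Finset.sum_insert hi]
    have hxi := hx i (Finset.mem_insert_self i s)
    have h1 := ih (fun j hj => hx j (Finset.mem_insert_of_mem hj))
      (fun j hj => hy j (Finset.mem_insert_of_mem hj))
    have h2 : ‖∏ j ∈ s, y j‖ ≤ 1 := by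
      rw [norm_prod]
      exact Finset.prod_le_one (fun j _ => norm_nonneg _)
        fun j hj => hy j (Finset.mem_insert_of_mem hj)
    calc ‖x i * ∏ j ∈ s, x j - y i * ∏ j ∈ s, y j‖
        = ‖x i * (∏ j ∈ s, x j - ∏ j ∈ s, y j) + (x i - y i) * ∏ j ∈ s, y j‖ := by ring_nf
      _ ≤ ‖x i‖ * ‖∏ j ∈ s, x j - ∏ j ∈ s, y j‖ + ‖x i - y i‖ * ‖∏ j ∈ s, y j‖ := by
          rw [← norm_mul, ← norm_mul]
          exact norm_add_le _ _
      _ ≤ 1 * ∑ j ∈ s, ‖x j - y j‖ + ‖x i - y i‖ * 1 := by gcongr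
      _ = _ := by ring

theorem sum_Ico_inv_mul_le {t : ℝ} (ht : 0 ≤ t) {g n : ℕ} (hg : 1 ≤ g) (hgn : g ≤ n) :
    ∑ k ∈ Finset.Ico g n, 1 / ((k + t) * (k + t + 1)) ≤ 1 / (g + t) := by
  have hg' : (1 : ℝ) ≤ g := by exact_mod_cast hg
  have key : ∑ k ∈ Finset.Ico g n, 1 / ((k + t) * (k + t + 1)) = 1 / (g + t) - 1 / (n + t) := by
    induction n, hgn using Nat.le_induction with
    | base => simp
    | succ n hn ih =>
      have hn' : (1 : ℝ) ≤ n := by exact_mod_cast hg.trans hn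
      rw [Finset.sum_Ico_succ_top hn, ih]
      push_cast
      have h1 : (n : ℝ) + t ≠ 0 := by positivity
      have h2 : (n : ℝ) + t + 1 ≠ 0 := by positivity
      have h3 : (n : ℝ) + 1 + t ≠ 0 := by positivity
      have h4 : (g : ℝ) + t ≠ 0 := by positivity
      field_simp
      ring
  rw [key]
  have : (0 : ℝ) ≤ 1 / (n + t) := by positivity
  linarith

/-- Second-order bound for the exponential on the whole closed left half-plane. -/
theorem norm_exp_sub_one_sub_self_le {z : ℂ} (hz : z.re ≤ 0) :
    ‖Complex.exp z - 1 - z‖ ≤ 3 * ‖z‖ ^ 2 := by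
  rcases le_total ‖z‖ 1 with h | h
  · refine (Complex.norm_exp_sub_one_sub_id_le h).trans ?_
    nlinarith [sq_nonneg ‖z‖]
  · have h1 : ‖Complex.exp z‖ ≤ 1 := by
      rw [Complex.norm_exp]
      exact Real.exp_le_one_iff.2 hz
    calc ‖Complex.exp z - 1 - z‖ ≤ ‖Complex.exp z‖ + ‖(1 : ℂ)‖ + ‖z‖ :=
          (norm_sub_le _ _).trans (add_le_add_left (norm_sub_le _ _) _)
      _ ≤ 1 + 1 + ‖z‖ := by
          rw [norm_one]
          gcongr
      _ ≤ 3 * ‖z‖ ^ 2 := by nlinarith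

theorem one_le_norm_one_add_mul_I_div (t : ℝ) (k : ℕ) : 1 ≤ ‖1 + t * Complex.I / k‖ := by
  have h : (1 + t * Complex.I / k : ℂ).re = 1 := by
    have : (t * Complex.I / k : ℂ) = ((t / k : ℝ) : ℂ) * Complex.I := by
      push_cast
      ring
    rw [this]
    simp
  calc (1 : ℝ) = |(1 + t * Complex.I / k : ℂ).re| := by rw [h, abs_one]
    _ ≤ _ := Complex.abs_re_le_norm _

theorem risingProd_mul_I_ne_zero (t : ℝ) (n : ℕ) : risingProd (t * Complex.I) n ≠ 0 := by
  refine Finset.prod_ne_zero_iff.2 fun k _ => norm_pos_iff.1 ?_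
  exact zero_lt_one.trans_le (one_le_norm_one_add_mul_I_div t k)

/-- On the imaginary axis, `risingProd s g / risingProd s n` is close to `(g / n) ^ s`. -/
theorem norm_risingProd_div_sub_le (t : ℝ) {g n : ℕ} (hg : 1 ≤ g) (hgn : g ≤ n) :
    ‖risingProd (t * Complex.I) g / risingProd (t * Complex.I) n
        - Complex.exp (t * Real.log (g / n) * Complex.I)‖ ≤ (6 * t ^ 2 + |t|) * (1 / g) := by
  -- both sides are products over `[g, n)` of numbers of modulus at most `1`
  set x : ℕ → ℂ := fun k => (1 + t * Complex.I / k)⁻¹ with hx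
  set y : ℕ → ℂ := fun k =>
    Complex.exp (-((t * (Real.log (k + 1) - Real.log k) : ℝ) * Complex.I)) with hy
  have hxprod : risingProd (t * Complex.I) g / risingProd (t * Complex.I) n
      = ∏ k ∈ Finset.Ico g n, x k := by
    rw [div_eq_iff (risingProd_mul_I_ne_zero t n), hx, Finset.prod_inv_distrib, risingProd,
      risingProd, ← Finset.prod_Ico_consecutive _ hg hgn, mul_left_comm, inv_mul_cancel₀, mul_one]
    refine Finset.prod_ne_zero_iff.2 fun k _ => norm_pos_iff.1 ?_
    exact zero_lt_one.trans_le (one_le_norm_one_add_mul_I_div t k)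
  have hyprod : Complex.exp (t * Real.log (g / n) * Complex.I) = ∏ k ∈ Finset.Ico g n, y k := by
    have hgR : (g : ℝ) ≠ 0 := by positivity
    have hnR : (n : ℝ) ≠ 0 := by
      have : 0 < n := by omega
      positivity
    rw [hy, ← Complex.exp_sum, Finset.sum_neg_distrib, ← Finset.sum_mul, ← Complex.ofReal_sum,
      ← Finset.mul_sum, Real.log_div hgR hnR]
    have : ∑ k ∈ Finset.Ico g n, (Real.log (k + 1) - Real.log k) = Real.log n - Real.log g := by
      have := Finset.sum_Ico_sub (fun k : ℕ => Real.log k) hgn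
      push_cast at this
      exact this
    rw [this]
    push_cast
    ring_nf
  have hxn : ∀ k, ‖x k‖ ≤ 1 := fun k => by
    rw [hx, norm_inv]
    exact inv_le_one_of_one_le₀ (one_le_norm_one_add_mul_I_div t k)
  have hyn : ∀ k, ‖y k‖ = 1 := fun k => by
    simp only [hy]
    rw [← neg_mul, ← Complex.ofReal_neg, Complex.norm_exp_ofReal_mul_I]
  rw [hxprod, hyprod]
  refine (norm_prod_sub_prod_le_sum _ _ _ (fun k _ => hxn k) fun k _ => (hyn k).le).trans ?_
  have hsum := sum_Ico_inv_mul_le le_rfl hg hgn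
  simp only [add_zero] at hsum
  refine le_trans ?_ (mul_le_mul_of_nonneg_left hsum (by positivity))
  rw [Finset.mul_sum]
  refine Finset.sum_le_sum fun k hk => ?_
  have hk1 : (1 : ℝ) ≤ k := by
    exact_mod_cast hg.trans (Finset.mem_Ico.1 hk).1
  have hk0 : (0 : ℝ) < k := by linarith
  set l : ℝ := Real.log (k + 1) - Real.log k with hl
  have hlog : l = Real.log ((k + 1) / k) := (Real.log_div (by positivity) hk0.ne').symm
  have hl1 : l ≤ 1 / k := by
    rw [hlog]
    refine (Real.log_le_sub_one_of_pos (by positivity)).trans (le_of_eq ?_)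
    field_simp
    ring
  have hl2 : 1 / (k + 1) ≤ l := by
    rw [hlog]
    refine le_trans (le_of_eq ?_) (Real.one_sub_inv_le_log_of_pos (by positivity))
    field_simp
    ring
  have hl0 : 0 ≤ l := le_trans (by positivity) hl2
  have hxk : x k * (1 + t * Complex.I / k) = 1 := by
    refine inv_mul_cancel₀ (norm_pos_iff.1 ?_)
    exact zero_lt_one.trans_le (one_le_norm_one_add_mul_I_div t k)
  have hyk : y k * Complex.exp ((t * l : ℝ) * Complex.I) = 1 := by
    change Complex.exp (-((t * l : ℝ) * Complex.I)) * _ = 1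
    rw [← Complex.exp_add, neg_add_cancel, Complex.exp_zero]
  have hxy : x k - y k =
      x k * y k * (Complex.exp ((t * l : ℝ) * Complex.I) - (1 + t * Complex.I / k)) := by
    linear_combination (-x k) * hyk + y k * hxk
  have hsplit : Complex.exp ((t * l : ℝ) * Complex.I) - (1 + t * Complex.I / k) =
      (Complex.exp ((t * l : ℝ) * Complex.I) - 1 - (t * l : ℝ) * Complex.I)
        + ((t * (l - 1 / k) : ℝ) : ℂ) * Complex.I := by
    push_cast
    ring
  have hb1 : ‖Complex.exp ((t * l : ℝ) * Complex.I) - 1 - (t * l : ℝ) * Complex.I‖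
      ≤ 3 * (t ^ 2 * (1 / k) ^ 2) := by
    refine (norm_exp_sub_one_sub_self_le (by simp)).trans ?_
    rw [norm_mul, Complex.norm_I, mul_one, Complex.norm_real, Real.norm_eq_abs, sq_abs, mul_pow]
    gcongr
  have hb2 : ‖((t * (l - 1 / k) : ℝ) : ℂ) * Complex.I‖ ≤ |t| * (1 / (k * (k + 1))) := by
    rw [norm_mul, Complex.norm_I, mul_one, Complex.norm_real, Real.norm_eq_abs, abs_mul]
    gcongr
    have : (1 : ℝ) / (k * (k + 1)) = 1 / k - 1 / (k + 1) := by
      field_simp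
      ring
    rw [this, abs_le]
    constructor <;> linarith
  have hb3 : (1 / (k : ℝ)) ^ 2 ≤ 2 * (1 / (k * (k + 1))) := by
    rw [div_pow, one_pow, mul_one_div, div_le_div_iff₀ (by positivity) (by positivity)]
    nlinarith
  calc ‖x k - y k‖ = ‖x k‖ * ‖y k‖ *
        ‖Complex.exp ((t * l : ℝ) * Complex.I) - (1 + t * Complex.I / k)‖ := by
        rw [hxy, norm_mul, norm_mul]
    _ ≤ 1 * 1 * (3 * (t ^ 2 * (1 / k) ^ 2) + |t| * (1 / (k * (k + 1)))) := by
        rw [hyn k, hsplit]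
        gcongr
        · exact hxn k
        · exact (norm_add_le _ _).trans (add_le_add hb1 hb2)
    _ ≤ 3 * (t ^ 2 * (2 * (1 / (k * (k + 1))))) + |t| * (1 / (k * (k + 1))) := by
        rw [one_mul, one_mul]
        gcongr
    _ = (6 * t ^ 2 + |t|) * (1 / (k * (k + 1))) := by ring

theorem log_one_add_inv {z : ℂ} (hz : 0 < z.re) :
    Complex.log (1 + z⁻¹) = Complex.log (z + 1) - Complex.log z := by
  have hz0 : z ≠ 0 := fun h => by simp [h] at hz
  have hre : 0 < (1 + z⁻¹).re := by
    rw [Complex.add_re, Complex.one_re, Complex.inv_re]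
    have : 0 < Complex.normSq z := Complex.normSq_pos.2 hz0
    positivity
  have h1 : (1 + z⁻¹) ≠ 0 := fun h => by simp [h] at hre
  have ha := Complex.abs_arg_lt_pi_div_two_iff.2 (Or.inl hz)
  have hb := Complex.abs_arg_lt_pi_div_two_iff.2 (Or.inl hre)
  rw [abs_lt] at ha hb
  have := (Complex.log_mul_eq_add_log_iff hz0 h1).2 ⟨by linarith, by linarith⟩
  rw [eq_sub_iff_add_eq, add_comm, ← this, mul_add, mul_inv_cancel₀ hz0, mul_one]

/-- The ratio of two values of `risingProd` on the imaginary axis at a bounded distance `a`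
behaves like a power with exponent `-a * I`. -/
theorem norm_risingProd_ratio_sub_le {a T : ℝ} (haT : 0 ≤ a * T) (ha : |a| ≤ |T|) (hT : 2 ≤ |T|)
    {n : ℕ} (hn : 1 ≤ n) :
    ‖risingProd ((T - a : ℝ) * Complex.I) n / risingProd (T * Complex.I) n
        - Complex.exp (-(a * Complex.I) *
          (Complex.log (n + T * Complex.I) - Complex.log (1 + T * Complex.I)))‖
      ≤ 4 * (12 * a ^ 2 + |a|) * (1 / (1 + |T|)) := by
  set z : ℕ → ℂ := fun k => k + T * Complex.I with hz
  have hzre : ∀ k, (z k).re = k := fun k => by simp [hz]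
  have hzim : ∀ k, (z k).im = T := fun k => by simp [hz]
  have hz0 : ∀ k ∈ Finset.Ico 1 n, z k ≠ 0 := fun k hk h => by
    have h1 := hzre k
    rw [h, Complex.zero_re] at h1
    have := (Finset.mem_Ico.1 hk).1
    have : k = 0 := by exact_mod_cast h1.symm
    omega
  -- `0 ≤ a * T` and `|a| ≤ |T|` give all the factors of both products modulus at most `1`
  set x : ℕ → ℂ := fun k => 1 - a * Complex.I * (z k)⁻¹ with hx
  set y : ℕ → ℂ := fun k => Complex.exp (-(a * Complex.I) * Complex.log (1 + (z k)⁻¹)) with hy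
  have hxprod : risingProd ((T - a : ℝ) * Complex.I) n / risingProd (T * Complex.I) n
      = ∏ k ∈ Finset.Ico 1 n, x k := by
    rw [risingProd, risingProd, ← Finset.prod_div_distrib]
    refine Finset.prod_congr rfl fun k hk => ?_
    have hk0 : (k : ℂ) ≠ 0 := by
      have := (Finset.mem_Ico.1 hk).1
      exact Nat.cast_ne_zero.2 (by omega)
    have h1 : (1 + T * Complex.I / k : ℂ) = z k / k := by
      rw [hz]
      field_simp
    have h2 : (1 + ((T - a : ℝ) : ℂ) * Complex.I / k : ℂ) = (z k - a * Complex.I) / k := by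
      rw [hz]
      push_cast
      field_simp
      ring
    have h3 := hz0 k hk
    rw [h1, h2, hx]
    field_simp
  have hyprod : Complex.exp (-(a * Complex.I) *
      (Complex.log (n + T * Complex.I) - Complex.log (1 + T * Complex.I)))
      = ∏ k ∈ Finset.Ico 1 n, y k := by
    rw [hy, ← Complex.exp_sum, ← Finset.mul_sum]
    have h1 : ∀ k ∈ Finset.Ico 1 n, Complex.log (1 + (z k)⁻¹) =
        Complex.log (z (k + 1)) - Complex.log (z k) := by
      intro k hk
      rw [log_one_add_inv]
      · congr 2
        simp only [hz]
        push_cast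
        ring
      · rw [hzre]
        exact_mod_cast (Finset.mem_Ico.1 hk).1
    rw [Finset.sum_congr rfl h1, Finset.sum_Ico_sub (fun k => Complex.log (z k)) hn]
    simp [hz]
  have hnormsq : ∀ k, ‖z k‖ ^ 2 = (k : ℝ) ^ 2 + T ^ 2 := fun k => by
    rw [← Complex.normSq_eq_norm_sq, Complex.normSq_apply, hzre, hzim]
    ring
  have hTz : ∀ k, |T| ≤ ‖z k‖ := fun k => by
    rw [← hzim k]
    exact Complex.abs_im_le_norm _
  have hw : ∀ k, ‖(z k)⁻¹‖ ≤ 1 / 2 := fun k => by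
    rw [norm_inv, one_div]
    exact inv_anti₀ two_pos (hT.trans (hTz k))
  have hxn : ∀ k ∈ Finset.Ico 1 n, ‖x k‖ ≤ 1 := fun k hk => by
    have h1 : x k = (k + ((T - a : ℝ) : ℂ) * Complex.I) / z k := by
      have := hz0 k hk
      rw [hx, eq_div_iff this]
      simp only [sub_mul, mul_assoc, inv_mul_cancel₀ this]
      rw [hz]
      push_cast
      ring
    rw [h1, norm_div]
    refine div_le_one_of_le₀ ?_ (norm_nonneg _)
    refine le_of_sq_le_sq ?_ (norm_nonneg _)
    rw [hnormsq, ← Complex.normSq_eq_norm_sq, ← Complex.ofReal_natCast,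
      Complex.normSq_add_mul_I]
    have : |a| * |a| ≤ |a| * |T| := by gcongr
    rw [← abs_mul, ← abs_mul, abs_of_nonneg haT, abs_of_nonneg (mul_self_nonneg a)] at this
    nlinarith
  have hlog1 : ∀ k, ‖Complex.log (1 + (z k)⁻¹) - (z k)⁻¹‖ ≤ ‖(z k)⁻¹‖ ^ 2 := fun k => by
    refine (Complex.norm_log_one_add_sub_self_le ((hw k).trans_lt (by norm_num))).trans ?_
    have h1 : (1 - ‖(z k)⁻¹‖)⁻¹ ≤ 2 := by
      rw [inv_le_comm₀ (by linarith [hw k]) two_pos]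
      linarith [hw k]
    nlinarith [sq_nonneg ‖(z k)⁻¹‖, mul_le_mul_of_nonneg_left h1 (sq_nonneg ‖(z k)⁻¹‖)]
  have hlog2 : ∀ k, ‖Complex.log (1 + (z k)⁻¹)‖ ≤ 2 * ‖(z k)⁻¹‖ := fun k => by
    have h1 := norm_le_norm_add_norm_sub' (Complex.log (1 + (z k)⁻¹)) (z k)⁻¹
    nlinarith [hlog1 k, hw k, norm_nonneg (z k)⁻¹]
  have hre : ∀ k, (-(a * Complex.I) * Complex.log (1 + (z k)⁻¹)).re ≤ 0 := fun k => by
    have h1 : (-(a * Complex.I) * Complex.log (1 + (z k)⁻¹)).re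
        = a * (1 + (z k)⁻¹).arg := by simp [Complex.log_im]
    have hpos : 0 < Complex.normSq (z k) := by
      rw [Complex.normSq_eq_norm_sq]
      have := hTz k
      have : 0 < ‖z k‖ := by linarith
      positivity
    have him : (1 + (z k)⁻¹).im = -T / Complex.normSq (z k) := by
      rw [Complex.add_im, Complex.one_im, Complex.inv_im, hzim, zero_add]
    rw [h1]
    rcases lt_trichotomy T 0 with h | h | h
    · have ha0 : a ≤ 0 := by
        by_contra hcon
        nlinarith
      have : 0 ≤ (1 + (z k)⁻¹).arg := by
        rw [Complex.arg_nonneg_iff, him]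
        exact div_nonneg (by linarith) hpos.le
      exact mul_nonpos_of_nonpos_of_nonneg ha0 this
    · rw [h, abs_zero] at hT
      linarith
    · have ha0 : 0 ≤ a := by
        by_contra hcon
        nlinarith
      have : (1 + (z k)⁻¹).arg < 0 := by
        rw [Complex.arg_neg_iff, him]
        exact div_neg_of_neg_of_pos (by linarith) hpos
      exact mul_nonpos_of_nonneg_of_nonpos ha0 this.le
  have hyn : ∀ k, ‖y k‖ ≤ 1 := fun k => by
    rw [hy, Complex.norm_exp]
    exact Real.exp_le_one_iff.2 (hre k)
  rw [hxprod, hyprod]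
  refine (norm_prod_sub_prod_le_sum _ _ _ hxn fun k _ => hyn k).trans ?_
  have hsum := sum_Ico_inv_mul_le (abs_nonneg T) le_rfl hn
  rw [Nat.cast_one] at hsum
  refine le_trans ?_ (mul_le_mul_of_nonneg_left hsum (by positivity))
  rw [Finset.mul_sum]
  refine Finset.sum_le_sum fun k hk => ?_
  have hk1 : (1 : ℝ) ≤ k := by exact_mod_cast (Finset.mem_Ico.1 hk).1
  set v : ℂ := -(a * Complex.I) * Complex.log (1 + (z k)⁻¹) with hv
  have hsplit : x k - y k = -(Complex.exp v - 1 - v)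
      + a * Complex.I * (Complex.log (1 + (z k)⁻¹) - (z k)⁻¹) := by
    simp only [hx, hy, hv]
    ring
  have hv1 : ‖v‖ ≤ |a| * (2 * ‖(z k)⁻¹‖) := by
    rw [hv, norm_mul, norm_neg, norm_mul, Complex.norm_I, mul_one, Complex.norm_real,
      Real.norm_eq_abs]
    gcongr
    exact hlog2 k
  have hw2 : ‖(z k)⁻¹‖ ^ 2 ≤ 4 * (1 / ((k + |T|) * (k + |T| + 1))) := by
    rw [norm_inv, inv_pow, hnormsq, ← one_div, mul_one_div,
      div_le_div_iff₀ (by positivity) (by positivity), ← sq_abs T]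
    nlinarith [sq_nonneg ((k : ℝ) - |T|), abs_nonneg T]
  calc ‖x k - y k‖ ≤ ‖Complex.exp v - 1 - v‖
        + ‖a * Complex.I * (Complex.log (1 + (z k)⁻¹) - (z k)⁻¹)‖ := by
        rw [hsplit, ← norm_neg (Complex.exp v - 1 - v)]
        exact norm_add_le _ _
    _ ≤ 3 * (|a| * (2 * ‖(z k)⁻¹‖)) ^ 2 + |a| * ‖(z k)⁻¹‖ ^ 2 := by
        refine add_le_add ((norm_exp_sub_one_sub_self_le (hre k)).trans ?_) ?_
        · gcongr
        · rw [norm_mul, norm_mul, Complex.norm_I, mul_one, Complex.norm_real, Real.norm_eq_abs]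
          gcongr
          exact hlog1 k
    _ = (12 * a ^ 2 + |a|) * ‖(z k)⁻¹‖ ^ 2 := by
        rw [mul_pow, sq_abs]
        ring
    _ ≤ (12 * a ^ 2 + |a|) * (4 * (1 / ((k + |T|) * (k + |T| + 1)))) := by gcongr
    _ = _ := by ring

/-! ### The limiting characteristic function -/

/-- The function `θ ↦ exp (-(π / 2) c |θ| + i c θ ln |θ|)`: the characteristic function of
`-c (Z + ln c)` for `Z` with the continuous Luria–Delbrück law. -/
noncomputable def limitCharFun (c θ : ℝ) : ℂ :=
  Complex.exp (((-(Real.pi / 2 * (c * |θ|)) : ℝ) : ℂ)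
    + ((c * (θ * Real.log |θ|) : ℝ) : ℂ) * Complex.I)

theorem continuous_limitCharFun (c : ℝ) : Continuous (limitCharFun c) := by
  unfold limitCharFun
  simp only [Real.log_abs]
  have := Real.continuous_mul_log
  fun_prop

theorem limitCharFun_zero (c : ℝ) : limitCharFun c 0 = 1 := by simp [limitCharFun]

theorem tendsto_log_natCast_atTop : Tendsto (fun n : ℕ => Real.log n) atTop atTop :=
  Real.tendsto_log_atTop.comp tendsto_natCast_atTop_atTop

theorem log_mul_I {θ : ℝ} (hθ : θ ≠ 0) :
    Complex.log (θ * Complex.I) =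
      Real.log |θ| + (Real.pi / 2 * SignType.sign θ : ℝ) * Complex.I := by
  rcases lt_or_gt_of_ne hθ with h | h
  · have : (θ * Complex.I : ℂ) = ((|θ| : ℝ) : ℂ) * (-Complex.I) := by
      rw [abs_of_neg h]
      push_cast
      ring
    rw [this, Complex.log_ofReal_mul (abs_pos.2 hθ) (by simp), Complex.log_neg_I, sign_neg h]
    push_cast
    simp
  · have : (θ * Complex.I : ℂ) = ((|θ| : ℝ) : ℂ) * Complex.I := by rw [abs_of_pos h]
    rw [this, Complex.log_ofReal_mul (abs_pos.2 hθ) (by simp), Complex.log_I, sign_pos h]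
    push_cast
    simp

/-- The limit of the Mellin transform at `s = i θ ln n`, divided by its value `risingProd s n` for a
cluster of size `n`; as `s p = i (θ ln n - θ c)`, only the exponent `a = θ c` matters. -/
theorem tendsto_risingProd_ratio {c θ : ℝ} (hc : 0 < c) (hθ : θ ≠ 0) :
    Tendsto (fun n : ℕ => risingProd ((θ * Real.log n - θ * c : ℝ) * Complex.I) n
        / risingProd ((θ * Real.log n : ℝ) * Complex.I) n
        * Complex.exp ((θ * c * (Real.log n - Real.log (Real.log n)) : ℝ) * Complex.I))
      atTop (𝓝 (limitCharFun c θ)) := by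
  -- `e n` approximates `f n`, and `r n` has modulus `1`
  set f : ℕ → ℂ := fun n => risingProd ((θ * Real.log n - θ * c : ℝ) * Complex.I) n
        / risingProd ((θ * Real.log n : ℝ) * Complex.I) n with hf
  set r : ℕ → ℂ := fun n =>
    Complex.exp ((θ * c * (Real.log n - Real.log (Real.log n)) : ℝ) * Complex.I) with hr
  set e : ℕ → ℂ := fun n => Complex.exp (-((θ * c : ℝ) * Complex.I) *
    (Complex.log (n + (θ * Real.log n : ℝ) * Complex.I)
      - Complex.log (1 + (θ * Real.log n : ℝ) * Complex.I))) with he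
  have hL := tendsto_log_natCast_atTop
  have hθ' : 0 < |θ| := abs_pos.2 hθ
  have habs : ∀ᶠ n : ℕ in atTop, |θ * Real.log n| = |θ| * Real.log n := by
    filter_upwards [hL.eventually_ge_atTop 0] with n hn
    rw [abs_mul, abs_of_nonneg hn]
  have hT : Tendsto (fun n : ℕ => |θ * Real.log n|) atTop atTop :=
    (hL.const_mul_atTop hθ').congr' (habs.mono fun n hn => hn.symm)
  have hfe : Tendsto (fun n => f n - e n) atTop (𝓝 0) := by
    refine squeeze_zero_norm' (a := fun n : ℕ =>
      4 * (12 * (θ * c) ^ 2 + |θ * c|) * (1 / (1 + |θ * Real.log n|))) ?_ ?_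
    · filter_upwards [hT.eventually_ge_atTop 2, hT.eventually_ge_atTop |θ * c|,
        hL.eventually_ge_atTop 0, eventually_ge_atTop 1] with n h1 h2 h3 h4
      refine norm_risingProd_ratio_sub_le ?_ h2 h1 h4
      have : θ * c * (θ * Real.log n) = θ ^ 2 * (c * Real.log n) := by ring
      rw [this]
      positivity
    · have h1 : Tendsto (fun n : ℕ => 1 / (1 + |θ * Real.log n|)) atTop (𝓝 0) := by
        simp only [one_div]
        exact (tendsto_atTop_add_const_left _ 1 hT).inv_tendsto_atTop
      simpa using h1.const_mul (4 * (12 * (θ * c) ^ 2 + |θ * c|))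
  have her : Tendsto (fun n => e n * r n) atTop (𝓝 (limitCharFun c θ)) := by
    have h1 : Tendsto (fun n : ℕ => Complex.exp (-((θ * c : ℝ) * Complex.I) *
        Complex.log (1 + (θ * (Real.log n / n) : ℝ) * Complex.I)
        + (θ * c : ℝ) * Complex.I * Complex.log (((Real.log n)⁻¹ : ℝ) + θ * Complex.I))) atTop
        (𝓝 (Complex.exp (-((θ * c : ℝ) * Complex.I) *
        Complex.log (1 + (θ * 0 : ℝ) * Complex.I)
        + (θ * c : ℝ) * Complex.I * Complex.log ((0 : ℝ) + θ * Complex.I)))) := by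
      have h2 : Tendsto (fun n : ℕ => Real.log n / n) atTop (𝓝 0) :=
        (Real.isLittleO_log_id_atTop.tendsto_div_nhds_zero).comp tendsto_natCast_atTop_atTop
      have h3 : Tendsto (fun n : ℕ => (Real.log n)⁻¹) atTop (𝓝 0) := hL.inv_tendsto_atTop
      refine (Complex.continuous_exp.tendsto _).comp (Tendsto.add ?_ ?_)
      · refine Tendsto.const_mul _ (Tendsto.clog ?_ (by simp))
        refine tendsto_const_nhds.add (Tendsto.mul_const _ ?_)
        exact (Complex.continuous_ofReal.tendsto _).comp (h2.const_mul θ)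
      · refine Tendsto.const_mul _ (Tendsto.clog ?_ ?_)
        · refine Tendsto.add_const _ ?_
          exact (Complex.continuous_ofReal.tendsto _).comp h3
        · rw [Complex.mem_slitPlane_iff]
          right
          simpa using hθ
    have hlim : Complex.exp (-((θ * c : ℝ) * Complex.I) *
        Complex.log (1 + (θ * 0 : ℝ) * Complex.I)
        + (θ * c : ℝ) * Complex.I * Complex.log ((0 : ℝ) + θ * Complex.I))
        = limitCharFun c θ := by
      have habsθ : |θ| = θ * SignType.sign θ := (self_mul_sign θ).symm
      rw [limitCharFun]
      congr 1
      rw [Complex.ofReal_zero, zero_add, log_mul_I hθ]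
      rw [show Real.pi / 2 * (c * |θ|) = Real.pi / 2 * (c * (θ * SignType.sign θ)) by
        rw [← habsθ]]
      simp only [mul_zero, Complex.ofReal_zero, zero_mul, add_zero, Complex.log_one, zero_add]
      push_cast
      ring_nf
      rw [Complex.I_sq]
      ring
    rw [← hlim]
    refine h1.congr' ?_
    filter_upwards [hL.eventually_gt_atTop 0, eventually_ge_atTop 1] with n hn hn1
    have hnR : (0 : ℝ) < n := by exact_mod_cast hn1
    have hnC : (n : ℂ) ≠ 0 := by exact_mod_cast hnR.ne'
    have hLC : (Real.log n : ℂ) ≠ 0 := by exact_mod_cast hn.ne'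
    -- factor out `n` and `log n` from the two arguments of the logarithm
    have e1 : Complex.log (n + (θ * Real.log n : ℝ) * Complex.I) = Real.log n +
        Complex.log (1 + (θ * (Real.log n / n) : ℝ) * Complex.I) := by
      rw [← Complex.log_ofReal_mul hnR]
      · congr 1
        push_cast
        field_simp
      · intro h
        simpa [-Complex.natCast_log] using congrArg Complex.re h
    have e2 : Complex.log (1 + (θ * Real.log n : ℝ) * Complex.I) = Real.log (Real.log n) +
        Complex.log (((Real.log n)⁻¹ : ℝ) + θ * Complex.I) := by
      rw [← Complex.log_ofReal_mul hn]
      · congr 1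
        push_cast
        rw [mul_add, mul_inv_cancel₀ (by simpa using hLC)]
        ring
      · intro h
        exact hθ (by simpa [-Complex.natCast_log] using congrArg Complex.im h)
    simp only [he, hr]
    rw [← Complex.exp_add, e1, e2]
    congr 1
    push_cast
    ring
  have hsum : Tendsto (fun n => (f n - e n) * r n + e n * r n) atTop
      (𝓝 (0 + limitCharFun c θ)) := by
    refine Tendsto.add ?_ her
    refine squeeze_zero_norm (a := fun n => ‖f n - e n‖) (fun n => ?_) (by simpa using hfe.norm)
    rw [norm_mul, hr, Complex.norm_exp_ofReal_mul_I, mul_one]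
  rw [zero_add] at hsum
  refine hsum.congr fun n => ?_
  ring

/-! ### The inverse moment of the root cluster size -/

/-- At `s = -1 / 2` the product dominates `1 / g`, while its expectation at the root cluster size
still decays polynomially in `n`. -/
theorem inv_le_re_risingProd_neg_half {g : ℕ} (hg : 1 ≤ g) :
    1 / (g : ℝ) ≤ (risingProd ((-(1 / 2) : ℝ) : ℂ) g).re := by
  have hreal : ∀ m : ℕ, risingProd ((-(1 / 2) : ℝ) : ℂ) m
      = ((∏ k ∈ Finset.Ico 1 m, (1 + (-(1 / 2)) / (k : ℝ)) : ℝ) : ℂ) := by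
    intro m
    rw [risingProd]
    push_cast
    rfl
  rw [hreal, Complex.ofReal_re]
  induction g, hg using Nat.le_induction with
  | base => simp
  | succ g hg ih =>
    have hgR : (1 : ℝ) ≤ g := by exact_mod_cast hg
    rw [Finset.prod_Ico_succ_top hg]
    have h1 : (0 : ℝ) ≤ 1 + (-(1 / 2)) / (g : ℝ) := by
      have : (1 : ℝ) / 2 / g ≤ 1 := by
        rw [div_le_one (by linarith)]
        linarith
      rw [neg_div]
      linarith
    refine le_trans ?_ (mul_le_mul_of_nonneg_right ih h1)
    push_cast
    have h2 : 1 / (g : ℝ) * (1 + (-(1 / 2)) / g) = (g - 1 / 2) / g ^ 2 := by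
      field_simp
      ring
    rw [h2, div_le_div_iff₀ (by positivity) (by positivity)]
    nlinarith

theorem norm_risingProd_neg_le {q : ℝ} (hq : 1 / 4 ≤ q) (hq1 : q ≤ 1) {n : ℕ} (hn : 1 ≤ n) :
    ‖risingProd ((-q : ℝ) : ℂ) n‖ ≤ Real.exp (-(1 / 4) * Real.log n) := by
  induction n, hn using Nat.le_induction with
  | base => simp [risingProd]
  | succ n hn ih =>
    have hnR : (1 : ℝ) ≤ n := by exact_mod_cast hn
    have hn0 : (0 : ℝ) < n := by linarith
    rw [risingProd_succ _ hn, norm_mul]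
    have hstep : ‖1 + ((-q : ℝ) : ℂ) / n‖
        ≤ Real.exp (-(1 / 4) * (Real.log (n + 1) - Real.log n)) := by
      have h1 : 1 + ((-q : ℝ) : ℂ) / n = ((1 - q / n : ℝ) : ℂ) := by
        push_cast
        ring
      have h2 : q / n ≤ 1 := by
        rw [div_le_one hn0]
        linarith
      rw [h1, Complex.norm_real, Real.norm_eq_abs, abs_of_nonneg (by linarith)]
      have h3 : Real.log (n + 1) - Real.log n ≤ 1 / n := by
        rw [← Real.log_div (by positivity) hn0.ne']
        refine (Real.log_le_sub_one_of_pos (by positivity)).trans (le_of_eq ?_)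
        field_simp
        ring
      have h4 : 1 / 4 * (1 / n) ≤ q / n := by
        rw [mul_one_div]
        gcongr
      have h5 := Real.add_one_le_exp (-(1 / 4) * (Real.log (n + 1) - Real.log n))
      linarith
    calc _ ≤ Real.exp (-(1 / 4) * Real.log n)
          * Real.exp (-(1 / 4) * (Real.log (n + 1) - Real.log n)) := by gcongr
      _ = _ := by
          rw [← Real.exp_add]
          push_cast
          ring_nf

/-- The root cluster is large: its inverse moment decays polynomially. -/
theorem integral_inv_rootClusterSize_le {n : ℕ} [NeZero n] {p : unitInterval}
    (hp : 1 / 2 ≤ (p : ℝ)) :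
    ∫ H, 1 / (rootClusterSize H : ℝ) ∂percolatedRecursiveTree n p
      ≤ Real.exp (-(1 / 4) * Real.log n) := by
  calc ∫ H, 1 / (rootClusterSize H : ℝ) ∂percolatedRecursiveTree n p
      ≤ ∫ H, (risingProd ((-(1 / 2) : ℝ) : ℂ) (rootClusterSize H)).re
          ∂percolatedRecursiveTree n p :=
        integral_mono Integrable.of_finite Integrable.of_finite
          fun H => inv_le_re_risingProd_neg_half rootClusterSize_pos
    _ = (∫ H, risingProd ((-(1 / 2) : ℝ) : ℂ) (rootClusterSize H)
          ∂percolatedRecursiveTree n p).re := Complex.reCLM.integral_comp_comm Integrable.of_finite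
    _ ≤ ‖risingProd ((-(1 / 2 * p) : ℝ) : ℂ) n‖ := by
        rw [integral_risingProd]
        refine (Complex.re_le_norm _).trans (le_of_eq ?_)
        congr 2
        push_cast
        ring
    _ ≤ _ := norm_risingProd_neg_le (by linarith) (by linarith [p.2.2])
        (Nat.one_le_iff_ne_zero.2 (NeZero.ne n))

/-! ### The characteristic function of the logarithm of the root cluster size -/

/-- The percolation parameter `1 - c / ln n`, clipped to the unit interval. -/
noncomputable def percParam (c : ℝ) (n : ℕ) : unitInterval :=
  Set.projIcc (0 : ℝ) 1 zero_le_one (1 - c / Real.log (n : ℝ))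

theorem percParam_eq {c : ℝ} (hc : 0 < c) {n : ℕ} (hn : c ≤ Real.log n) :
    (percParam c n : ℝ) = 1 - c / Real.log n := by
  have hL : 0 < Real.log n := hc.trans_le hn
  have h1 : c / Real.log n ≤ 1 := (div_le_one hL).2 hn
  have h2 : 0 ≤ c / Real.log n := by positivity
  rw [percParam, Set.projIcc_of_mem zero_le_one ⟨by linarith, by linarith⟩]

/-- The normalised logarithm of the root cluster size. -/
noncomputable def logStat (c : ℝ) (n : ℕ) [NeZero n] (H : SimpleGraph (Fin n)) : ℝ :=
  Real.log n * (Real.log (rootClusterSize H / n) + c) - c * Real.log (Real.log n)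

/-- The characteristic function of `ln (G / n)` is close to a quotient of two explicit products. -/
theorem norm_integral_exp_log_sub_le (t : ℝ) {n : ℕ} [NeZero n] {p : unitInterval}
    (hp : 1 / 2 ≤ (p : ℝ)) :
    ‖∫ H, Complex.exp (t * Real.log (rootClusterSize H / n) * Complex.I)
        ∂percolatedRecursiveTree n p
      - risingProd ((t * p : ℝ) * Complex.I) n / risingProd (t * Complex.I) n‖
      ≤ (6 * t ^ 2 + |t|) * Real.exp (-(1 / 4) * Real.log n) := by
  have h1 : risingProd ((t * p : ℝ) * Complex.I) n / risingProd (t * Complex.I) n =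
      ∫ H, risingProd (t * Complex.I) (rootClusterSize H) / risingProd (t * Complex.I) n
        ∂percolatedRecursiveTree n p := by
    rw [integral_div, integral_risingProd]
    congr 2
    push_cast
    ring
  rw [h1, ← integral_sub Integrable.of_finite Integrable.of_finite]
  calc _ ≤ ∫ H, (6 * t ^ 2 + |t|) * (1 / (rootClusterSize H : ℝ))
        ∂percolatedRecursiveTree n p := by
        refine norm_integral_le_of_norm_le Integrable.of_finite (ae_of_all _ fun H => ?_)
        rw [norm_sub_rev]
        exact norm_risingProd_div_sub_le t rootClusterSize_pos rootClusterSize_le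
    _ ≤ _ := by
        rw [integral_const_mul]
        gcongr
        exact integral_inv_rootClusterSize_le hp

theorem tendsto_integral_exp_logStat {c : ℝ} (hc : 0 < c) (θ : ℝ) :
    Tendsto (fun m : ℕ => ∫ H, Complex.exp (θ * logStat c (m + 1) H * Complex.I)
      ∂percolatedRecursiveTree (m + 1) (percParam c (m + 1))) atTop (𝓝 (limitCharFun c θ)) := by
  rcases eq_or_ne θ 0 with rfl | hθ
  · simp [limitCharFun_zero]
  have hL := tendsto_log_natCast_atTop
  set r : ℕ → ℂ := fun n =>
    Complex.exp ((θ * c * (Real.log n - Real.log (Real.log n)) : ℝ) * Complex.I) with hr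
  set err : ℕ → ℝ := fun n => (6 * (θ * Real.log n) ^ 2 + |θ * Real.log n|)
    * Real.exp (-(1 / 4) * Real.log n) with herr
  have herr0 : Tendsto err atTop (𝓝 0) := by
    have hx : Tendsto (fun n : ℕ => 1 / 4 * Real.log n) atTop atTop :=
      hL.const_mul_atTop (by norm_num)
    have h1 := (Real.tendsto_pow_mul_exp_neg_atTop_nhds_zero 2).comp hx
    have h2 := (Real.tendsto_pow_mul_exp_neg_atTop_nhds_zero 1).comp hx
    have h3 := (h1.const_mul (96 * θ ^ 2)).add (h2.const_mul (4 * |θ|))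
    rw [mul_zero, mul_zero, add_zero] at h3
    refine h3.congr' ?_
    filter_upwards [hL.eventually_ge_atTop 0] with n hn
    simp only [Function.comp_apply, herr]
    rw [abs_mul, abs_of_nonneg hn, neg_mul]
    ring
  have hmain := tendsto_risingProd_ratio hc hθ
  have hshift : Tendsto (fun m : ℕ => m + 1) atTop atTop := tendsto_add_atTop_nat 1
  have hdiff : Tendsto (fun m : ℕ => (∫ H, Complex.exp (θ * logStat c (m + 1) H * Complex.I)
      ∂percolatedRecursiveTree (m + 1) (percParam c (m + 1)))
      - risingProd ((θ * Real.log (m + 1 : ℕ) - θ * c : ℝ) * Complex.I) (m + 1)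
        / risingProd ((θ * Real.log (m + 1 : ℕ) : ℝ) * Complex.I) (m + 1) * r (m + 1))
      atTop (𝓝 0) := by
    refine squeeze_zero_norm' ?_ (herr0.comp hshift)
    filter_upwards [hshift.eventually ((hL.eventually_ge_atTop (2 * c)))] with m hm
    have hLpos : 0 < Real.log (m + 1 : ℕ) := by linarith
    have hp := percParam_eq hc (n := m + 1) (by linarith)
    have hp2 : 1 / 2 ≤ (percParam c (m + 1) : ℝ) := by
      have : c / Real.log (m + 1 : ℕ) ≤ 1 / 2 := by
        rw [div_le_div_iff₀ hLpos two_pos]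
        linarith
      rw [hp]
      linarith
    have hbound := norm_integral_exp_log_sub_le (θ * Real.log (m + 1 : ℕ)) (n := m + 1) hp2
    have htp : θ * Real.log (m + 1 : ℕ) * (percParam c (m + 1) : ℝ)
        = θ * Real.log (m + 1 : ℕ) - θ * c := by
      rw [hp]
      field_simp
    rw [htp] at hbound
    have hint : ∫ H, Complex.exp (θ * logStat c (m + 1) H * Complex.I)
        ∂percolatedRecursiveTree (m + 1) (percParam c (m + 1))
        = (∫ H, Complex.exp ((θ * Real.log (m + 1 : ℕ) : ℝ)
          * Real.log (rootClusterSize H / (m + 1 : ℕ)) * Complex.I)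
          ∂percolatedRecursiveTree (m + 1) (percParam c (m + 1))) * r (m + 1) := by
      rw [← integral_mul_const]
      congr 1
      ext H
      rw [hr, ← Complex.exp_add, logStat]
      congr 1
      push_cast
      ring
    rw [hint, ← sub_mul, norm_mul, hr, Complex.norm_exp_ofReal_mul_I, mul_one]
    exact hbound
  have := hdiff.add (hmain.comp hshift)
  rw [zero_add] at this
  refine this.congr fun m => ?_
  simp only [Function.comp_apply, hr]
  ring

/-! ### Existence of the continuous Luria–Delbrück law -/

/-- A pointwise limit of characteristic functions that is continuous at `0` is a characteristic
function. -/
theorem exists_charFun_eq_of_tendsto {μ : ℕ → ProbabilityMeasure ℝ} {f : ℝ → ℂ}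
    (hf : ContinuousAt f 0)
    (h : ∀ t, Tendsto (fun n => charFun (μ n : Measure ℝ) t) atTop (𝓝 (f t))) :
    ∃ ν : ProbabilityMeasure ℝ, ∀ t, charFun (ν : Measure ℝ) t = f t := by
  have h_tight : IsTightMeasureSet {(μ n : Measure ℝ) | n} :=
    isTightMeasureSet_of_tendsto_charFun hf h
  have h_compact : IsCompact (closure {μ n | n}) :=
    isCompact_closure_of_isTightMeasureSet (by simpa using h_tight)
  obtain ⟨ν, -, hν : Tendsto _ _ _⟩ := h_compact.ultrafilter_le_nhds
    ((hyperfilter ℕ).map μ) (.trans (by simp) (monotone_principal subset_closure))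
  refine ⟨ν, fun t => ?_⟩
  refine tendsto_nhds_unique ?_ ((h t).mono_left Nat.hyperfilter_le_atTop)
  rw [ProbabilityMeasure.tendsto_iff_forall_integral_rclike_tendsto ℂ] at hν
  simp_rw [charFun_eq_integral_innerProbChar]
  exact hν _

/-- The law of the normalised logarithm of the root cluster size in a tree on `m + 1` vertices. -/
noncomputable def logStatLaw (c : ℝ) (m : ℕ) : Measure ℝ :=
  (percolatedRecursiveTree (m + 1) (percParam c (m + 1))).map (logStat c (m + 1))

instance (c : ℝ) (m : ℕ) : IsProbabilityMeasure (logStatLaw c m) :=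
  Measure.isProbabilityMeasure_map Measurable.of_discrete.aemeasurable

theorem tendsto_charFun_logStatLaw {c : ℝ} (hc : 0 < c) (θ : ℝ) :
    Tendsto (fun m => charFun (logStatLaw c m) θ) atTop (𝓝 (limitCharFun c θ)) := by
  refine (tendsto_integral_exp_logStat hc θ).congr fun m => ?_
  rw [charFun_apply_real, logStatLaw, integral_map Measurable.of_discrete.aemeasurable
    (by fun_prop)]

theorem exists_isContinuousLuriaDelbruck :
    ∃ (ν : Measure ℝ) (_ : IsProbabilityMeasure ν), IsContinuousLuriaDelbruck ν := by
  obtain ⟨ν, hν⟩ := exists_charFun_eq_of_tendsto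
    (μ := fun m => ⟨logStatLaw 1 m, inferInstance⟩)
    (continuous_limitCharFun 1).continuousAt (tendsto_charFun_logStatLaw one_pos)
  refine ⟨(ν : Measure ℝ).map (-1 * ·), Measure.isProbabilityMeasure_map (by fun_prop),
    fun θ => ?_⟩
  rw [charFun_map_mul, hν, limitCharFun]
  congr 1
  rw [neg_one_mul, abs_neg]
  push_cast
  ring

/-! ### From the logarithm of the cluster size to the cluster size -/

/-- The normalised root cluster size. -/
noncomputable def sizeStat (c : ℝ) (n : ℕ) [NeZero n] (H : SimpleGraph (Fin n)) : ℝ :=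
  ((rootClusterSize H : ℝ) / (n : ℝ) - Real.exp (-c)) * Real.log (n : ℝ)
    - c * Real.exp (-c) * Real.log (Real.log (n : ℝ))

/-- Linearisation of the logarithm of the root cluster size. -/
theorem abs_sizeStat_sub_le {c K : ℝ} (hc : 0 < c) {n : ℕ} [NeZero n] {H : SimpleGraph (Fin n)}
    (hL : 1 ≤ Real.log n) (hK : |logStat c n H| ≤ K)
    (hKL : K + c * Real.log (Real.log n) ≤ Real.log n) :
    |sizeStat c n H - Real.exp (-c) * logStat c n H|
      ≤ (K + c * Real.log (Real.log n)) ^ 2 / Real.log n := by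
  have hG : (0 : ℝ) < rootClusterSize H := by exact_mod_cast rootClusterSize_pos
  have hn : (0 : ℝ) < n := by exact_mod_cast Nat.pos_of_ne_zero (NeZero.ne n)
  set L := Real.log n with hLdef
  have hL0 : 0 < L := by linarith
  have hLL : 0 ≤ c * Real.log L := mul_nonneg hc.le (Real.log_nonneg hL)
  set u := Real.log (rootClusterSize H / n) + c with hu
  have hV : logStat c n H = L * u - c * Real.log L := rfl
  have huL : L * |u| ≤ K + c * Real.log L := by
    rw [← abs_of_pos hL0, ← abs_mul, abs_of_pos hL0]
    have : L * u = logStat c n H + c * Real.log L := by rw [hV]; ring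
    rw [this]
    refine (abs_add_le _ _).trans ?_
    rw [abs_of_nonneg hLL]
    gcongr
  have hu1 : |u| ≤ 1 := by
    by_contra hcon
    push Not at hcon
    nlinarith
  have hexp : (rootClusterSize H : ℝ) / n = Real.exp (-c) * Real.exp u := by
    rw [hu, Real.exp_add, Real.exp_log (by positivity), Real.exp_neg]
    field_simp
  have hdiff : sizeStat c n H - Real.exp (-c) * logStat c n H
      = Real.exp (-c) * (L * (Real.exp u - 1 - u)) := by
    rw [sizeStat, hexp, hV]
    ring
  rw [hdiff, abs_mul, abs_mul, abs_of_pos hL0, abs_of_pos (Real.exp_pos _)]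
  have hc1 : Real.exp (-c) ≤ 1 := Real.exp_le_one_iff.2 (by linarith)
  calc Real.exp (-c) * (L * |Real.exp u - 1 - u|) ≤ 1 * (L * u ^ 2) := by
        gcongr
        exact Real.abs_exp_sub_one_sub_id_le hu1
    _ = (L * |u|) ^ 2 / L := by
        rw [mul_pow, sq_abs]
        field_simp
    _ ≤ _ := by gcongr

theorem norm_exp_mul_I_sub_le (x y : ℝ) :
    ‖Complex.exp (x * Complex.I) - Complex.exp (y * Complex.I)‖ ≤ |x - y| := by
  have h : Complex.exp (x * Complex.I) - Complex.exp (y * Complex.I)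
      = Complex.exp (y * Complex.I) * (Complex.exp (Complex.I * (x - y : ℝ)) - 1) := by
    rw [mul_sub, ← Complex.exp_add, mul_one]
    congr 2
    push_cast
    ring
  rw [h, norm_mul, Complex.norm_exp_ofReal_mul_I, one_mul]
  exact Real.norm_exp_I_mul_ofReal_sub_one_le

theorem tendsto_sq_add_log_div_atTop (K c : ℝ) :
    Tendsto (fun x : ℝ => (K + c * Real.log x) ^ 2 / x) atTop (𝓝 0) := by
  have h0 : Tendsto (fun x : ℝ => x⁻¹) atTop (𝓝 0) := tendsto_inv_atTop_zero
  have h1 : Tendsto (fun x : ℝ => Real.log x ^ 1 / (1 * x + 0)) atTop (𝓝 0) :=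
    Real.tendsto_pow_log_div_mul_add_atTop 1 0 1 one_ne_zero
  have h2 : Tendsto (fun x : ℝ => Real.log x ^ 2 / (1 * x + 0)) atTop (𝓝 0) :=
    Real.tendsto_pow_log_div_mul_add_atTop 1 0 2 one_ne_zero
  have h := ((h0.const_mul (K ^ 2)).add (h1.const_mul (2 * K * c))).add (h2.const_mul (c ^ 2))
  simp only [mul_zero, add_zero, one_mul, pow_one] at h
  refine h.congr fun x => ?_
  ring

/-- The normalised cluster size is `exp (-c)` times the normalised logarithm, up to an error that
vanishes in probability. -/
theorem tendsto_integral_exp_sizeStat {c : ℝ} (hc : 0 < c) (θ : ℝ) :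
    Tendsto (fun m : ℕ => ∫ H, Complex.exp (θ * sizeStat c (m + 1) H * Complex.I)
      ∂percolatedRecursiveTree (m + 1) (percParam c (m + 1))) atTop
      (𝓝 (limitCharFun c (Real.exp (-c) * θ))) := by
  have hlog := tendsto_integral_exp_logStat hc (Real.exp (-c) * θ)
  suffices hdiff : Tendsto (fun m : ℕ =>
      (∫ H, Complex.exp (θ * sizeStat c (m + 1) H * Complex.I)
        ∂percolatedRecursiveTree (m + 1) (percParam c (m + 1)))
      - ∫ H, Complex.exp (((Real.exp (-c) * θ : ℝ) : ℂ) * logStat c (m + 1) H * Complex.I)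
        ∂percolatedRecursiveTree (m + 1) (percParam c (m + 1))) atTop (𝓝 0) by
    simpa using hdiff.add hlog
  have hL : Tendsto (fun m : ℕ => Real.log (m + 1 : ℕ)) atTop atTop :=
    tendsto_log_natCast_atTop.comp (tendsto_add_atTop_nat 1)
  rw [Metric.tendsto_atTop']
  intro ε hε
  -- tightness confines `logStat` to a bounded interval, up to a small probability
  have htight : IsTightMeasureSet (Set.range (logStatLaw c)) :=
    isTightMeasureSet_of_tendsto_charFun (continuous_limitCharFun c).continuousAt
      (tendsto_charFun_logStatLaw hc)
  obtain ⟨K, hK⟩ := ((tendsto_measure_norm_gt_of_isTightMeasureSet htight).eventually_le_const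
    (show (0 : ENNReal) < ENNReal.ofReal (ε / 8) by simpa using hε)).exists
  have hKm : ∀ m, (percolatedRecursiveTree (m + 1) (percParam c (m + 1))).real
      {H | K < |logStat c (m + 1) H|} ≤ ε / 8 := by
    intro m
    have h1 : logStatLaw c m {x | K < ‖x‖} ≤ ENNReal.ofReal (ε / 8) :=
      le_trans (le_iSup₂_of_le (logStatLaw c m) ⟨m, rfl⟩ le_rfl) hK
    rw [logStatLaw, Measure.map_apply Measurable.of_discrete
      (measurableSet_lt measurable_const measurable_norm)] at h1
    exact ENNReal.toReal_le_of_le_ofReal (by positivity) h1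
  have hb : Tendsto (fun m : ℕ => |θ| * ((K + c * Real.log (Real.log (m + 1 : ℕ))) ^ 2
      / Real.log (m + 1 : ℕ))) atTop (𝓝 0) := by
    simpa using ((tendsto_sq_add_log_div_atTop K c).comp hL).const_mul |θ|
  have hKL : ∀ᶠ x : ℝ in atTop, K + c * Real.log x ≤ x := by
    have h1 := ((Asymptotics.isLittleO_const_id_atTop K).add
      (Real.isLittleO_log_id_atTop.const_mul_left c)).bound one_pos
    filter_upwards [h1, eventually_ge_atTop 0] with x hx hx0
    rw [one_mul, Real.norm_eq_abs, Real.norm_eq_abs, id, abs_of_nonneg hx0] at hx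
    exact (le_abs_self _).trans hx
  have hev := ((hL.eventually_ge_atTop 1).and (hL.eventually hKL)).and
    (hb.eventually_lt_const (show 0 < ε / 2 by positivity))
  obtain ⟨N, hN⟩ := eventually_atTop.1 hev
  refine ⟨N, fun m hm => ?_⟩
  obtain ⟨⟨hL1, hKL1⟩, hb1⟩ := hN m hm.le
  set P := percolatedRecursiveTree (m + 1) (percParam c (m + 1)) with hP
  set A : Set (SimpleGraph (Fin (m + 1))) := {H | K < |logStat c (m + 1) H|} with hA
  rw [dist_zero_right, ← integral_sub Integrable.of_finite Integrable.of_finite]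
  have hpoint : ∀ H : SimpleGraph (Fin (m + 1)),
      ‖Complex.exp (θ * sizeStat c (m + 1) H * Complex.I)
        - Complex.exp (((Real.exp (-c) * θ : ℝ) : ℂ) * logStat c (m + 1) H * Complex.I)‖
      ≤ ε / 2 + A.indicator (fun _ => 2) H := by
    intro H
    by_cases hH : H ∈ A
    · rw [Set.indicator_of_mem hH, ← Complex.ofReal_mul, ← Complex.ofReal_mul]
      refine (norm_sub_le _ _).trans ?_
      rw [Complex.norm_exp_ofReal_mul_I, Complex.norm_exp_ofReal_mul_I]
      linarith
    · rw [Set.indicator_of_notMem hH, add_zero, ← Complex.ofReal_mul, ← Complex.ofReal_mul]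
      refine (norm_exp_mul_I_sub_le _ _).trans ?_
      have h1 : θ * sizeStat c (m + 1) H - Real.exp (-c) * θ * logStat c (m + 1) H
          = θ * (sizeStat c (m + 1) H - Real.exp (-c) * logStat c (m + 1) H) := by ring
      rw [h1, abs_mul]
      refine le_trans ?_ hb1.le
      gcongr
      exact abs_sizeStat_sub_le hc hL1 (not_lt.1 hH) hKL1
  calc _ ≤ ∫ H, (ε / 2 + A.indicator (fun _ => 2) H) ∂P :=
        norm_integral_le_of_norm_le Integrable.of_finite (ae_of_all _ hpoint)
    _ = ε / 2 + P.real A * 2 := by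
        rw [integral_add Integrable.of_finite Integrable.of_finite,
          integral_indicator MeasurableSet.of_discrete]
        simp
    _ < ε := by linarith [hKm m]

theorem charFun_map_neg_mul_add_log {ν : Measure ℝ} [IsProbabilityMeasure ν]
    (hν : IsContinuousLuriaDelbruck ν) {c : ℝ} (hc : 0 < c) (θ : ℝ) :
    charFun (ν.map fun z : ℝ => -c * Real.exp (-c) * (z + Real.log c)) θ
      = limitCharFun c (Real.exp (-c) * θ) := by
  set η := Real.exp (-c) * θ with hη
  have h1 : charFun (ν.map fun z : ℝ => -c * Real.exp (-c) * (z + Real.log c)) θ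
      = charFun ν (-(c * η)) * Complex.exp (((-(c * η) * Real.log c : ℝ) : ℂ) * Complex.I) := by
    rw [charFun_apply_real, charFun_apply_real, integral_map (by fun_prop) (by fun_prop),
      ← integral_mul_const]
    congr 1
    ext z
    rw [← Complex.exp_add, hη]
    congr 1
    push_cast
    ring
  rw [h1, hν, limitCharFun, ← Complex.exp_add]
  rcases eq_or_ne η 0 with h | h
  · simp [h]
  · rw [abs_neg, abs_mul, abs_of_pos hc, Real.log_mul hc.ne' (abs_pos.2 h).ne']
    congr 1
    push_cast
    ring

theorem tendsto_natPred_atTop : Tendsto PNat.natPred atTop atTop := by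
  refine tendsto_atTop.2 fun b => ?_
  filter_upwards [eventually_ge_atTop b.succPNat] with n hn
  have : b + 1 ≤ (n : ℕ) := by exact_mod_cast hn
  have h2 := PNat.natPred_add_one n
  omega

theorem theorem1 :
    ∃ (ν : Measure ℝ) (_ : IsProbabilityMeasure ν), IsContinuousLuriaDelbruck ν ∧
      ∀ c : ℝ, 0 < c →
        TendstoInDistribution
          (fun (n : ℕ+) (H : SimpleGraph (Fin n)) =>
            ((rootClusterSize H : ℝ) / (n : ℝ) - Real.exp (-c)) * Real.log (n : ℝ)
              - c * Real.exp (-c) * Real.log (Real.log (n : ℝ)))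
          atTop
          (fun z : ℝ => -c * Real.exp (-c) * (z + Real.log c))
          (fun n : ℕ+ =>
            percolatedRecursiveTree n
              (Set.projIcc (0 : ℝ) 1 zero_le_one (1 - c / Real.log (n : ℝ))))
          ν := by
  obtain ⟨ν, hprob, hν⟩ := exists_isContinuousLuriaDelbruck
  refine ⟨ν, hprob, hν, fun c hc => ⟨fun n => Measurable.of_discrete.aemeasurable,
    by fun_prop, ?_⟩⟩
  have hmeas : ∀ n : ℕ+, AEMeasurable (sizeStat c n)
      (percolatedRecursiveTree n (percParam c n)) := fun n => Measurable.of_discrete.aemeasurable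
  let F : ℕ+ → ProbabilityMeasure ℝ := fun n =>
    ⟨(percolatedRecursiveTree n (percParam c n)).map (sizeStat c n),
      Measure.isProbabilityMeasure_map (hmeas n)⟩
  have hlimit : AEMeasurable (fun z : ℝ => -c * Real.exp (-c) * (z + Real.log c)) ν := by fun_prop
  have key : Tendsto (fun m : ℕ => F m.succPNat) atTop
      (𝓝 ⟨ν.map fun z : ℝ => -c * Real.exp (-c) * (z + Real.log c),
        Measure.isProbabilityMeasure_map hlimit⟩) := by
    refine ProbabilityMeasure.tendsto_iff_tendsto_charFun.2 fun θ => ?_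
    change Tendsto _ _ (𝓝 (charFun (ν.map _) θ))
    rw [charFun_map_neg_mul_add_log hν hc]
    refine (tendsto_integral_exp_sizeStat hc θ).congr fun m => ?_
    change _ = charFun (Measure.map _ _) θ
    rw [charFun_apply_real, integral_map (hmeas m.succPNat) (by fun_prop)]
    rfl
  have hF : F = (fun m : ℕ => F m.succPNat) ∘ PNat.natPred := by
    ext1 n
    simp
  change Tendsto F atTop _
  rw [hF]
  exact key.comp tendsto_natPred_atTop
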